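/- Let $k\in\mathbb N$ and let $\widetilde A:[-\pi,\pi]\to M_{2k}(\mathbb C)$ be a matrix function with measurable, essentially bounded entries and $\widetilde A(-\pi)=\widetilde A(\pi)$. Put $\|\widetilde A\|=\operatorname{ess\,sup}_{\theta\in[-\pi,\pi]}\|\widetilde A(\theta)\|$ (operator norm), and for $n\in\mathbb Z$ let $$A_n=\frac1{2\pi}\int_{-\pi}^{\pi}\widetilde A(\theta)e^{-\imath n\theta}\,d\theta .$$ For $n\in\mathbb N$ let $T_n(\widetilde A)=[A_{i-j}]_{i,j=0}^{n-1}$, a $2nk\times 2nk$ matrix. Let $l^2_{2k}$ be the Hilbert space of square summable sequences $(x_0,x_1,\dots)$ in $\mathbb C^{2k}$, and let $\Sigma=T(\widetilde A)=[A_{i-j}]_{i,j=0}^{\infty}$ be the bounded block Toeplitz operator on $l^2_{2k}$ generated by $\widetilde A$. Assume that $\Sigma$ is partially symmetric (every $A_n$ is a real matrix and $A_{-n}=A_n$ for all $n$) and positive invertible (Hermitian, positive definite and invertible). For a real symmetric positive definite $2m\times 2m$ matrix $B$, let $d_1(B)\le\cdots\le d_m(B)$ denote its symplectic eigenvalues: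 the positive numbers, uniquely determined by $B$, for which $MBM^T=d_1(B)I_2\oplus\cdots\oplus d_m(B)I_2$ for some real matrix $M$ with $MJ_{2m}M^T=J_{2m}$, where $J_{2m}=J_2\oplus\cdots\oplus J_2$ ($m$ summands) and $J_2=\begin{bmatrix}0&1\\-1&0\end{bmatrix}$. Then the symplectic eigenvalues $d_1^{(n)}\le\cdots\le d_{nk}^{(n)}$ of $T_n(\widetilde A)$ exist for every $n$, the symplectic eigenvalues $d_j(\widetilde A(\theta))$, $1\le j\le k$, exist for almost every $\theta\in[-\pi,\pi]$, and for every continuous real- or complex-valued function $f$ on $[0,\|\widetilde A\|]$ the function $\theta\mapsto\sum_{j=1}^k f(d_j(\widetilde A(\theta)))$ is integrable on $[-\pi,\pi]$ and $$\lim_{n\to\infty}\frac1n\sum_{j=1}^{nk}f\big(d_j^{(n)}\big)=\frac1{2\pi}\int_{-\pi}^{\pi}\sum_{j=1}^{k}f\big(d_j(\widetilde A(\theta))\big)\,d\theta .$$ -/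

import Mathlib

open MeasureTheory Filter Topology Set
open scoped Kronecker ENNReal Real

noncomputable section

namespace SymplecticSzego

/-- The space of complex `2m × 2m` matrices, the index `(j, s) : Fin m × Fin 2` being
row or column number `2 j + s`. -/
abbrev CMat (m : ℕ) : Type := Matrix (Fin m × Fin 2) (Fin m × Fin 2) ℂ

/-- The matrix `J = J₂ ⊕ ⋯ ⊕ J₂` (`m` summands), where `J₂ = [[0, 1], [-1, 0]]`. -/
def J (m : ℕ) : Matrix (Fin m × Fin 2) (Fin m × Fin 2) ℝ :=
  (1 : Matrix (Fin m) (Fin m) ℝ) ⊗ₖ !![0, 1; -1, 0]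

/-- `d 0 ≤ ⋯ ≤ d (m - 1)` are the symplectic eigenvalues of the `2m × 2m` matrix `A`: they are
positive, and `M A Mᵀ = d 0 I₂ ⊕ ⋯ ⊕ d (m - 1) I₂` for some real symplectic matrix `M`.
Matrices are taken with complex entries because the values of a symbol are complex matrices;
the displayed identity forces `A` to be real, symmetric and positive definite. -/
def IsSymplecticSpectrum {m : ℕ} (A : CMat m) (d : Fin m → ℝ) : Prop :=
  Monotone d ∧ (∀ j, 0 < d j) ∧
    ∃ M : Matrix (Fin m × Fin 2) (Fin m × Fin 2) ℝ,
      M * J m * M.transpose = J m ∧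
      M.map Complex.ofReal * A * (M.map Complex.ofReal).transpose =
        Matrix.diagonal (fun p : Fin m × Fin 2 => (d p.1 : ℂ))

open Classical in
/-- The symplectic eigenvalues `d 0 ≤ ⋯ ≤ d (m - 1)` of `A` (they exist and are unique when `A`
is real symmetric positive definite; for any other matrix the value is `0`). -/
def symplecticEigenvalues {m : ℕ} (A : CMat m) : Fin m → ℝ :=
  if h : ∃ d, IsSymplecticSpectrum A d then h.choose else 0

/-- `L^∞` symbols: matrix functions on `[-π, π]` with equal values at the end points and
measurable, essentially bounded entries (values off `[-π, π]` play no role). -/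
def IsLInftySymbol {k : ℕ} (A : ℝ → CMat k) : Prop :=
  A (-π) = A π ∧ ∀ a b, MemLp (fun θ => A θ a b) ∞ (volume.restrict (Icc (-π) π))

/-- The norm of a symbol: the essential supremum over `[-π, π]` of the operator norm of `A θ`
on `ℂ^{2k}` with its Euclidean norm. -/
def symbolNorm {k : ℕ} (A : ℝ → CMat k) : ℝ :=
  essSup (fun θ => ‖Matrix.toEuclideanCLM (n := Fin k × Fin 2) (𝕜 := ℂ) (A θ)‖)
    (volume.restrict (Icc (-π) π))

/-- The Fourier coefficients `A_n = (2π)⁻¹ ∫ A(θ) e^{-inθ} dθ`, taken entrywise. -/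
def fourierBlock {k : ℕ} (A : ℝ → CMat k) (n : ℤ) : CMat k :=
  Matrix.of fun a b =>
    (2 * (π : ℂ))⁻¹ * ∫ θ in (-π)..π, A θ a b * Complex.exp (-Complex.I * n * θ)

/-- The truncated `n × n` block Toeplitz matrix `[A_{i-j}]`, `0 ≤ i, j ≤ n - 1`, as a
`2nk × 2nk` matrix: `finProdFinEquiv` is the numbering `(i, r) ↦ k i + r`. -/
def truncation {k : ℕ} (A : ℝ → CMat k) (n : ℕ) : CMat (n * k) :=
  Matrix.of fun p q =>
    let i : Fin n × Fin k := finProdFinEquiv.symm p.1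
    let j : Fin n × Fin k := finProdFinEquiv.symm q.1
    fourierBlock A ((i.1 : ℤ) - (j.1 : ℤ)) (i.2, p.2) (j.2, q.2)

/-- The Hilbert space `l²_{2k}` of square summable sequences in `ℂ^{2k}`. -/
abbrev L2Seq (k : ℕ) : Type := lp (fun _ : ℕ => EuclideanSpace ℂ (Fin k × Fin 2)) 2

/-- The bounded operator `T` on `l²_{2k}` is the block Toeplitz operator `[A_{i-j}]`, `i, j ≥ 0`,
generated by the symbol `A`. -/
def IsGeneratedBy {k : ℕ} (T : L2Seq k →L[ℂ] L2Seq k) (A : ℝ → CMat k) : Prop :=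
  ∀ (i j : ℕ) (a b : Fin k × Fin 2),
    T (lp.single 2 j (EuclideanSpace.single b (1 : ℂ))) i a =
      fourierBlock A ((i : ℤ) - (j : ℤ)) a b

/-- The block Toeplitz operator with symbol `A` is partially symmetric: every `A_n` is a real
matrix, and `A_{-n} = A_n`. -/
def IsPartiallySymmetric {k : ℕ} (A : ℝ → CMat k) : Prop :=
  (∀ (n : ℤ) a b, (fourierBlock A n a b).im = 0) ∧
    ∀ n : ℤ, fourierBlock A (-n) = fourierBlock A n

/-- A Hermitian operator that is positive definite and invertible. -/
def IsPositiveInvertible {H : Type*} [NormedAddCommGroup H] [InnerProductSpace ℂ H]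
    (T : H →L[ℂ] H) : Prop :=
  T.IsPositive ∧ (∀ x, inner ℂ x (T x) = 0 → x = 0) ∧ IsUnit T

end SymplecticSzego

end

open SymplecticSzego

/-!
# A Szegő limit theorem for symplectic eigenvalues

Write `B` for the symbol `J A`. By Williamson's theorem a real positive definite matrix `X` is
symplectically congruent to `D = d₀ I₂ ⊕ ⋯ ⊕ d_{m-1} I₂`, and then `J X` is similar to `J D`. Hence
`-(J X)²` is similar to `D²`: the even power sums of the symplectic eigenvalues are
`∑ⱼ dⱼ^{2q} = ½ (-1)^q tr (J X)^{2q}` (`IsSymplecticSpectrum.sum_pow_eq`), and `dⱼ ≤ ‖X‖`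
(`IsSymplecticSpectrum.le_norm`) because `J` is unitary. Since `J` is block diagonal with constant
blocks, `J T_n(A) = T_n(B)` (`complexJ_mul_truncation`). So the theorem for `f(x) = x^{2q}` is the
statement that `n⁻¹ tr T_n(B)^{2q}` tends to the mean of `tr B^{2q}`, for a bounded symbol that is
not Hermitian (`tendsto_trace_blockToeplitz_pow`), and the general case follows by approximating
`f(√y)` uniformly by polynomials in `y` (`integrable_and_tendsto_of_moments`).

The trace limit holds because `T_n` is multiplicative up to an error that is `o(√n)` in Frobenius
norm. The defect `T_n(bc) - T_n(b) T_n(c)` of scalar symbols has as its `j`-th column Fourier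
coefficients of `b vⱼ`, where `vⱼ` is the part of `c eʲ` with frequencies outside `[0, n)`. By
Bessel its squared norm is at most `‖b‖∞² ‖vⱼ‖²`, and by Parseval `‖vⱼ‖²` is a tail of the
convergent series `∑ |ĉ(m)|²`, so that the average over `j` vanishes in the limit
(`tendsto_toeplitzDefect`).

Existence of the symplectic eigenvalues needs positive definiteness. A positive invertible operator
is bounded below by some `c > 0`, and the truncations, being compressions, inherit the bound. For
the symbol, the form of the Toeplitz operator on trigonometric polynomials times a fixed vector `v`
is, up to a shift of frequencies, the form of multiplication by `v* A(θ) v` on `L²`; density of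
trigonometric polynomials and indicator functions as test functions give `v* A(θ) v ≥ c |v|²` almost
everywhere (`ae_le_re_of_toeplitz_form_ge`, `ae_form_ge`), and countably many `v` suffice. The
symbol is real and symmetric because its Fourier coefficients are.

Fourier analysis is done on the circle `AddCircle (2π)`, through the representatives in `(-π, π]`.
-/

open SymplecticSzego

namespace SymplecticSzego

/-! ### Normal form of skew-adjoint operators -/

section SkewNormalForm

/-- Normal form of an injective skew-adjoint operator on a real inner product space of dimension
`2m`: an orthonormal family of `m` pairs on each of which it acts as `d j • J₂`. -/
theorem exists_orthonormal_skew_pairs (m : ℕ) :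
    ∀ (E : Type) [NormedAddCommGroup E] [InnerProductSpace ℝ E] [FiniteDimensional ℝ E]
      (_ : Module.finrank ℝ E = 2 * m) (K : E →ₗ[ℝ] E)
      (_ : ∀ x y, inner ℝ (K x) y = -inner ℝ x (K y)) (_ : Function.Injective K),
      ∃ (b : Fin m × Fin 2 → E) (d : Fin m → ℝ), Orthonormal ℝ b ∧
        ∀ j, 0 < d j ∧ K (b (j, 0)) = -d j • b (j, 1) ∧ K (b (j, 1)) = d j • b (j, 0) := by
  induction m with
  | zero =>
    intro E _ _ _ _ K _ _
    exact ⟨fun p => p.1.elim0, fun j => j.elim0, ⟨fun p => p.1.elim0, fun p => p.1.elim0⟩,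
      fun j => j.elim0⟩
  | succ m ih =>
    intro E _ _ _ hfr K hK hinj
    have hsym : (K ∘ₗ K).IsSymmetric := by
      intro x y
      simp only [LinearMap.comp_apply, hK, neg_neg]
    -- A unit eigenvector `e` of the symmetric operator `K²`.
    have hn : 0 < Module.finrank ℝ E := by omega
    set e : E := hsym.eigenvectorBasis rfl ⟨0, hn⟩ with he
    set μ : ℝ := hsym.eigenvalues rfl ⟨0, hn⟩ with hμ
    have hKK : K (K e) = μ • e :=
      hsym.apply_eigenvectorBasis rfl ⟨0, hn⟩
    have hen : ‖e‖ = 1 := (hsym.eigenvectorBasis rfl).orthonormal.1 _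
    have hKe : K e ≠ 0 := fun h => by
      have : e = 0 := hinj (by rw [h, map_zero])
      rw [this, norm_zero] at hen
      exact zero_ne_one hen
    set l : ℝ := ‖K e‖ with hl
    have hl0 : 0 < l := norm_pos_iff.2 hKe
    have hee : inner ℝ e e = (1 : ℝ) := by rw [real_inner_self_eq_norm_sq, hen]; norm_num
    have hμl : μ = -l ^ 2 := by
      have h1 : inner ℝ (K e) (K e) = l ^ 2 := real_inner_self_eq_norm_sq _
      rw [hK, hKK, inner_smul_right, hee] at h1
      linarith
    set f : E := -l⁻¹ • K e with hf
    have hKe' : K e = -l • f := by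
      rw [hf, smul_smul]; field_simp; simp
    have hKf : K f = l • e := by
      rw [hf, map_smul, hKK, smul_smul, hμl]
      congr 1; field_simp
    have hfn : ‖f‖ = 1 := by
      rw [hf, norm_smul, ← hl, norm_neg, norm_inv, Real.norm_of_nonneg hl0.le,
        inv_mul_cancel₀ hl0.ne']
    have hff : inner ℝ f f = (1 : ℝ) := by rw [real_inner_self_eq_norm_sq, hfn]; norm_num
    have heKe : inner ℝ e (K e) = (0 : ℝ) := by
      have h := hK e e
      rw [real_inner_comm] at h
      linarith
    have hef : inner ℝ e f = (0 : ℝ) := by rw [hf, inner_smul_right, heKe, mul_zero]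
    have hfe : inner ℝ f e = (0 : ℝ) := by rw [real_inner_comm, hef]
    have hon : Orthonormal ℝ ![e, f] := by
      rw [orthonormal_iff_ite]
      intro i j
      fin_cases i <;> fin_cases j <;> simp [hen, hfn, hef, hfe]
    -- The orthogonal complement of the plane of `e` and `f` is invariant under `K`.
    set W : Submodule ℝ E := (Submodule.span ℝ (Set.range ![e, f]))ᗮ with hW
    have hmemW : ∀ x, x ∈ W ↔ inner ℝ e x = (0 : ℝ) ∧ inner ℝ f x = (0 : ℝ) := by
      intro x
      rw [hW, Submodule.mem_orthogonal]
      constructor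
      · intro h
        exact ⟨h e (Submodule.subset_span ⟨0, rfl⟩), h f (Submodule.subset_span ⟨1, rfl⟩)⟩
      · rintro ⟨h1, h2⟩ u hu
        induction hu using Submodule.span_induction with
        | mem u hu =>
          obtain ⟨i, rfl⟩ := hu
          fin_cases i
          · exact h1
          · exact h2
        | zero => simp
        | add u v _ _ hu hv => rw [inner_add_left, hu, hv, add_zero]
        | smul a u _ hu => rw [inner_smul_left, hu, mul_zero]
    have hKW : ∀ x ∈ W, K x ∈ W := by
      intro x hx
      obtain ⟨h1, h2⟩ := (hmemW x).1 hx
      rw [hmemW]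
      constructor
      · have h := hK e x
        rw [hKe', inner_smul_left, h2, mul_zero] at h
        linarith
      · have h := hK f x
        rw [hKf, inner_smul_left, h1, mul_zero] at h
        linarith
    have hWfr : Module.finrank ℝ W = 2 * m := by
      have h1 := Submodule.finrank_add_finrank_orthogonal (Submodule.span ℝ (Set.range ![e, f]))
      rw [finrank_span_eq_card hon.linearIndependent, hfr, ← hW, Fintype.card_fin] at h1
      omega
    obtain ⟨b, d, hb, hbd⟩ := ih W hWfr (K.restrict hKW)
      (fun x y => hK x y)
      (fun x y hxy => Subtype.ext (hinj (congrArg Subtype.val hxy)))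
    have hWe : ∀ w : W, inner ℝ e (w : E) = (0 : ℝ) := fun w => ((hmemW w).1 w.2).1
    have hWf : ∀ w : W, inner ℝ f (w : E) = (0 : ℝ) := fun w => ((hmemW w).1 w.2).2
    have hWe' : ∀ w : W, inner ℝ (w : E) e = (0 : ℝ) := fun w => by rw [real_inner_comm, hWe]
    have hWf' : ∀ w : W, inner ℝ (w : E) f = (0 : ℝ) := fun w => by rw [real_inner_comm, hWf]
    refine ⟨fun p => Fin.cases (![e, f] p.2) (fun j => (b (j, p.2) : E)) p.1,
      Fin.cases l d, ?_, ?_⟩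
    · rw [orthonormal_iff_ite] at hb ⊢
      rintro ⟨i, s⟩ ⟨j, t⟩
      refine Fin.cases ?_ (fun i => ?_) i <;> refine Fin.cases ?_ (fun j => ?_) j
      · fin_cases s <;> fin_cases t <;> simp [hen, hfn, hef, hfe]
      · fin_cases s <;> simp [hWe, hWf, (Fin.succ_ne_zero j).symm]
      · fin_cases t <;> simp [hWe', hWf']
      · have h := hb (i, s) (j, t)
        rw [Submodule.coe_inner] at h
        simpa using h
    · intro j
      refine Fin.cases ?_ (fun j => ?_) j
      · exact ⟨hl0, hKe', hKf⟩
      · obtain ⟨h0, h1, h2⟩ := hbd j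
        exact ⟨h0, congrArg Subtype.val h1, congrArg Subtype.val h2⟩

end SkewNormalForm

/-! ### Williamson's theorem -/

section Williamson

open Matrix
open scoped ComplexOrder

theorem J_apply (m : ℕ) (p q : Fin m × Fin 2) :
    J m p q = if p.1 = q.1 then (!![0, 1; -1, 0] : Matrix (Fin 2) (Fin 2) ℝ) p.2 q.2 else 0 := by
  simp [J, Matrix.kroneckerMap_apply, Matrix.one_apply]

theorem J_transpose (m : ℕ) : (J m)ᵀ = -J m := by
  ext ⟨i, s⟩ ⟨j, t⟩
  rw [transpose_apply, Matrix.neg_apply, J_apply, J_apply]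
  simp only [eq_comm (a := j)]
  split_ifs
  · fin_cases s <;> fin_cases t <;> simp
  · simp

theorem J_mul_J (m : ℕ) : J m * J m = -1 := by
  rw [J, ← Matrix.mul_kronecker_mul, Matrix.mul_one]
  have : (!![0, 1; -1, 0] : Matrix (Fin 2) (Fin 2) ℝ) * !![0, 1; -1, 0] = -1 := by
    ext i j; fin_cases i <;> fin_cases j <;> simp
  rw [this]
  ext ⟨i, s⟩ ⟨j, t⟩
  simp [Matrix.kroneckerMap_apply, Matrix.one_apply, Prod.ext_iff]
  aesop

/-- **Williamson's theorem**, before ordering: a real symmetric positive definite matrix is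
symplectically congruent to `d 0 I₂ ⊕ ⋯ ⊕ d (m - 1) I₂` with positive `d j`. -/
theorem exists_symplectic_diagonalization {m : ℕ}
    {B : Matrix (Fin m × Fin 2) (Fin m × Fin 2) ℝ} (hB : B.PosDef) :
    ∃ (d : Fin m → ℝ) (M : Matrix (Fin m × Fin 2) (Fin m × Fin 2) ℝ), (∀ j, 0 < d j) ∧
      M * J m * Mᵀ = J m ∧ M * B * Mᵀ = diagonal fun p => d p.1 := by
  open scoped MatrixOrder Matrix.Norms.L2Operator in
  obtain ⟨C, hC, hBC⟩ := CStarAlgebra.isStrictlyPositive_iff_eq_star_mul_self.1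
    hB.isStrictlyPositive
  have hCB : B = Cᵀ * C := by
    rw [hBC, star_eq_conjTranspose, conjTranspose_eq_transpose_of_trivial]
  have hCdet : IsUnit C.det := (Matrix.isUnit_iff_isUnit_det C).1 hC
  have hCdet' : IsUnit Cᵀ.det := by rwa [det_transpose]
  -- `X` is a congruence of `B` to the identity; it carries `J` to an invertible skew matrix.
  set X : Matrix (Fin m × Fin 2) (Fin m × Fin 2) ℝ := (Cᵀ)⁻¹ with hX
  have hXB : X * B * Xᵀ = 1 := by
    rw [hX, hCB, transpose_nonsing_inv, transpose_transpose, ← Matrix.mul_assoc,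
      nonsing_inv_mul _ hCdet', Matrix.one_mul, mul_nonsing_inv _ hCdet]
  set S : Matrix (Fin m × Fin 2) (Fin m × Fin 2) ℝ := X * J m * Xᵀ with hS
  have hSt : Sᵀ = -S := by
    rw [hS, transpose_mul, transpose_mul, transpose_transpose, J_transpose, Matrix.neg_mul,
      Matrix.mul_neg, Matrix.mul_assoc]
  have hSinv : (Cᵀ * S * C) = J m := by
    rw [hS, hX, transpose_nonsing_inv, transpose_transpose, Matrix.mul_assoc, Matrix.mul_assoc,
      nonsing_inv_mul _ hCdet, Matrix.mul_one, ← Matrix.mul_assoc, mul_nonsing_inv _ hCdet',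
      Matrix.one_mul]
  have hSinj : Function.Injective S.mulVec := by
    have h1 : (-(C * J m * Cᵀ)) * S = 1 := by
      have : C * (J m * (Cᵀ * S * C)) * C⁻¹ = -1 := by
        rw [hSinv, J_mul_J, Matrix.mul_neg, Matrix.neg_mul, Matrix.mul_one,
          mul_nonsing_inv _ hCdet]
      rw [Matrix.neg_mul, neg_eq_iff_eq_neg, ← this]
      simp only [Matrix.mul_assoc, mul_nonsing_inv _ hCdet, Matrix.mul_one]
    intro v w hvw
    have := congrArg (fun u => (-(C * J m * Cᵀ)) *ᵥ u) hvw
    simpa only [mulVec_mulVec, h1, one_mulVec] using this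
  set K := Matrix.toEuclideanLin S with hK
  have hKapp : ∀ v, (K v).ofLp = S *ᵥ v.ofLp := fun v => rfl
  have hinner : ∀ u v : EuclideanSpace ℝ (Fin m × Fin 2), inner ℝ u v = u.ofLp ⬝ᵥ v.ofLp := by
    intro u v
    rw [EuclideanSpace.inner_eq_star_dotProduct, dotProduct_comm]
    simp
  obtain ⟨b, δ, hb, hbδ⟩ := exists_orthonormal_skew_pairs m
    (EuclideanSpace ℝ (Fin m × Fin 2)) (by simp [mul_comm]) K
    (by
      intro x y
      rw [hinner, hinner, hKapp, hKapp, dotProduct_mulVec, ← mulVec_transpose, hSt, neg_mulVec,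
        neg_dotProduct, neg_neg])
    (by
      intro v w hvw
      have := congrArg WithLp.ofLp hvw
      rw [hKapp, hKapp] at this
      exact WithLp.ofLp_injective 2 (hSinj this))
  set O : Matrix (Fin m × Fin 2) (Fin m × Fin 2) ℝ := Matrix.of fun p q => b p q with hO
  have hOO : O * Oᵀ = 1 := by
    ext p q
    rw [orthonormal_iff_ite] at hb
    have := hb p q
    rw [hinner] at this
    rw [Matrix.one_apply, ← this]
    rfl
  have hOS : O * S * Oᵀ = Matrix.of fun p q : Fin m × Fin 2 => δ p.1 * J m p q := by
    ext p ⟨j, t⟩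
    have h1 : (O * S * Oᵀ) p (j, t) = inner ℝ (b p) (K (b (j, t))) := by
      rw [hinner, hKapp, Matrix.mul_assoc]
      rfl
    rw [orthonormal_iff_ite] at hb
    obtain ⟨i, s⟩ := p
    rw [h1, of_apply, J_apply]
    obtain ⟨-, h2, h3⟩ := hbδ j
    fin_cases t
    · simp only [Fin.zero_eta, h2, inner_smul_right, hb, Prod.mk.injEq]
      by_cases hij : i = j
      · subst hij; fin_cases s <;> simp
      · simp [hij]
    · simp only [Fin.mk_one, h3, inner_smul_right, hb, Prod.mk.injEq]
      by_cases hij : i = j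
      · subst hij; fin_cases s <;> simp
      · simp [hij]
  -- Rescaling the rows by `(δ j)^(-1/2)` turns the skew normal form into `J`.
  set c : Fin m × Fin 2 → ℝ := fun p => (Real.sqrt (δ p.1))⁻¹ with hc
  have hcc : ∀ j, (Real.sqrt (δ j))⁻¹ * (Real.sqrt (δ j))⁻¹ = (δ j)⁻¹ := fun j => by
    rw [← mul_inv, Real.mul_self_sqrt (hbδ j).1.le]
  have hconj : ∀ Z : Matrix (Fin m × Fin 2) (Fin m × Fin 2) ℝ,
      (diagonal c * O * X) * Z * (diagonal c * O * X)ᵀ =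
        diagonal c * (O * (X * Z * Xᵀ) * Oᵀ) * diagonal c := by
    intro Z
    simp only [transpose_mul, diagonal_transpose, Matrix.mul_assoc]
  refine ⟨fun j => (δ j)⁻¹, diagonal c * O * X, fun j => inv_pos.2 (hbδ j).1, ?_, ?_⟩
  · rw [hconj, ← hS, hOS]
    ext p q
    rw [mul_diagonal, diagonal_mul, of_apply, J_apply]
    by_cases hpq : p.1 = q.1
    · rw [if_pos hpq]
      simp only [hc, ← hpq]
      have := (hbδ p.1).1.ne'
      rw [mul_right_comm, ← mul_assoc, hcc, inv_mul_cancel₀ this, one_mul]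
    · simp only [if_neg hpq, mul_zero, zero_mul]
  · rw [hconj, hXB, Matrix.mul_one, hOO, Matrix.mul_one, diagonal_mul_diagonal]
    simp only [hc, hcc]

theorem map_ofReal_mul {m : ℕ} (X Y : Matrix (Fin m × Fin 2) (Fin m × Fin 2) ℝ) :
    (X * Y).map Complex.ofReal = X.map Complex.ofReal * Y.map Complex.ofReal :=
  Matrix.map_mul (f := Complex.ofRealHom)

/-- **Williamson's theorem** for a complex matrix with real entries: the symplectic eigenvalues,
in increasing order, exist. -/
theorem exists_isSymplecticSpectrum {m : ℕ} {A : CMat m} (hreal : ∀ a b, (A a b).im = 0)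
    (hA : A.PosDef) : ∃ d, IsSymplecticSpectrum A d := by
  set B : Matrix (Fin m × Fin 2) (Fin m × Fin 2) ℝ := A.map Complex.re with hB
  have hAB : A = B.map Complex.ofReal := by
    ext a b
    exact Complex.ext rfl (by simp [hreal])
  have hBpos : B.PosDef := by
    refine PosDef.of_dotProduct_mulVec_pos ?_ fun x hx => ?_
    · ext a b
      have := congrArg Complex.re (hA.1.apply a b)
      simpa [hB] using this
    · have hx' : (fun a => (x a : ℂ)) ≠ 0 := fun h => hx (by
        ext a; exact Complex.ofReal_eq_zero.1 (congrFun h a))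
      have h1 := hA.dotProduct_mulVec_pos hx'
      have h2 : star (fun a => (x a : ℂ)) ⬝ᵥ (A *ᵥ fun a => (x a : ℂ)) =
          ((star x ⬝ᵥ (B *ᵥ x) : ℝ) : ℂ) := by
        rw [hAB]
        simp [dotProduct, mulVec]
      rw [h2] at h1
      exact_mod_cast h1
  obtain ⟨d, M, hd, hMJ, hMB⟩ := exists_symplectic_diagonalization hBpos
  set σ := Tuple.sort d with hσ
  set τ : Fin m × Fin 2 ≃ Fin m × Fin 2 := σ.prodCongr (Equiv.refl _) with hτ
  have hsub : ∀ Z : Matrix (Fin m × Fin 2) (Fin m × Fin 2) ℝ,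
      M.submatrix τ id * Z * (M.submatrix τ id)ᵀ = (M * Z * Mᵀ).submatrix τ τ := by
    intro Z
    ext p q
    simp [Matrix.mul_apply]
  refine ⟨d ∘ σ, Tuple.monotone_sort d, fun j => hd _, M.submatrix τ id, ?_, ?_⟩
  · rw [hsub, hMJ]
    ext p q
    simp [J_apply, hτ]
  · have h := hsub B
    rw [hMB] at h
    have h2 := congrArg (fun Z => Z.map Complex.ofReal) h
    simp only [map_ofReal_mul] at h2
    rw [hAB]
    refine Eq.trans h2 ?_
    ext p q
    by_cases hpq : p = q
    · subst hpq
      simp [hτ]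
    · simp [hpq]

theorem isSymplecticSpectrum_symplecticEigenvalues {m : ℕ} {A : CMat m}
    (h : ∃ d, IsSymplecticSpectrum A d) : IsSymplecticSpectrum A (symplecticEigenvalues A) := by
  rw [symplecticEigenvalues, dif_pos h]
  exact h.choose_spec

end Williamson

/-! ### Symplectic eigenvalues and powers of `J A` -/

section TraceFormula

open Matrix
open scoped Matrix.Norms.L2Operator

/-- The matrix `J` with complex entries. -/
def complexJ (m : ℕ) : CMat m := (J m).map Complex.ofReal

theorem complexJ_mul_self (m : ℕ) : complexJ m * complexJ m = -1 := by
  rw [complexJ, ← map_ofReal_mul, J_mul_J]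
  ext p q
  simp [Matrix.one_apply, apply_ite]

theorem complexJ_apply (m : ℕ) (p q : Fin m × Fin 2) : complexJ m p q =
    if p.1 = q.1 then ((!![0, 1; -1, 0] : Matrix (Fin 2) (Fin 2) ℝ) p.2 q.2 : ℂ) else 0 := by
  rw [complexJ, map_apply, J_apply]
  split_ifs <;> simp

theorem norm_complexJ_le (m : ℕ) : ‖complexJ m‖ ≤ 1 := by
  have h : (complexJ m)ᴴ = -complexJ m := by
    have h1 : (complexJ m)ᴴ = (J m)ᵀ.map Complex.ofReal := by
      ext p q
      simp [complexJ]
    rw [h1, J_transpose]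
    ext p q
    simp [complexJ]
  have h2 := l2_opNorm_conjTranspose_mul_self (complexJ m)
  rw [h, Matrix.neg_mul, complexJ_mul_self, neg_neg] at h2
  have h3 : ‖(1 : CMat m)‖ ≤ 1 := by
    rw [← diagonal_one, l2_opNorm_diagonal]
    exact pi_norm_le_iff_of_nonneg zero_le_one |>.2 fun _ => by simp
  nlinarith [norm_nonneg (complexJ m)]

/-- The matrix `-(J A)²`. For real positive definite `A` its eigenvalues are the squares of the
symplectic eigenvalues of `A`, each with multiplicity two. -/
def negSqJMul {m : ℕ} (A : CMat m) : CMat m := -((complexJ m * A) * (complexJ m * A))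

/-- If `M J Mᵀ = J` and `M A Mᵀ = D`, then `Mᵀ` conjugates `J D` to `J A`; here `D` commutes with
`J`, so that `-(J D)² = D²`. -/
theorem IsSymplecticSpectrum.negSqJMul_similar {m : ℕ} {A : CMat m} {d : Fin m → ℝ}
    (h : IsSymplecticSpectrum A d) : ∃ P Q : CMat m, Q * P = 1 ∧ P * Q = 1 ∧
      negSqJMul A = P * diagonal (fun p => ((d p.1 : ℂ)) ^ 2) * Q := by
  obtain ⟨-, -, M, hMJ, hMA⟩ := h
  set N : CMat m := M.map Complex.ofReal with hN
  set D : CMat m := diagonal fun p : Fin m × Fin 2 => (d p.1 : ℂ) with hD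
  set I := complexJ m with hI
  have hII : I * I = -1 := complexJ_mul_self m
  have hNJ : N * I * Nᵀ = I := by
    have := congrArg (fun Z => Z.map Complex.ofReal) hMJ
    simp only [map_ofReal_mul] at this
    exact this
  -- `-I N I` is the inverse of `Nᵀ`.
  have h1 : (-(I * N * I)) * Nᵀ = 1 := by
    rw [Matrix.neg_mul, Matrix.mul_assoc I N I, Matrix.mul_assoc, hNJ, hII, neg_neg]
  have h2 : Nᵀ * (-(I * N * I)) = 1 := mul_eq_one_comm.1 h1
  have h3 : (-(I * Nᵀ * I)) * N = 1 := by
    refine mul_eq_one_comm.1 ?_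
    rw [Matrix.mul_neg, ← Matrix.mul_assoc, ← Matrix.mul_assoc, hNJ, hII, neg_neg]
  have hA : A = (-(I * Nᵀ * I)) * D * (-(I * N * I)) := by
    rw [← hMA]
    calc A = ((-(I * Nᵀ * I)) * N) * A * (Nᵀ * (-(I * N * I))) := by
          rw [h3, h2, Matrix.one_mul, Matrix.mul_one]
      _ = _ := by simp only [Matrix.mul_assoc]
  have hIA : I * A = Nᵀ * (I * D) * (-(I * N * I)) := by
    rw [hA]
    calc I * ((-(I * Nᵀ * I)) * D * (-(I * N * I)))
        = -(I * I) * (Nᵀ * (I * D) * (-(I * N * I))) := by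
          simp only [Matrix.mul_assoc, Matrix.neg_mul, Matrix.mul_neg]
      _ = _ := by rw [hII, neg_neg, Matrix.one_mul]
  have hcomm : I * D = D * I := by
    ext p q
    rw [hD, mul_diagonal, diagonal_mul, hI, complexJ_apply]
    by_cases hpq : p.1 = q.1
    · rw [hpq, mul_comm]
    · simp only [if_neg hpq, zero_mul, mul_zero]
  have hDD : D * D = diagonal fun p : Fin m × Fin 2 => (d p.1 : ℂ) ^ 2 := by
    rw [hD, diagonal_mul_diagonal]
    simp only [sq]
  refine ⟨Nᵀ, -(I * N * I), h1, h2, ?_⟩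
  rw [negSqJMul, ← hI, hIA, ← hDD]
  calc -(Nᵀ * (I * D) * (-(I * N * I)) * (Nᵀ * (I * D) * (-(I * N * I))))
      = -(Nᵀ * (I * D) * ((-(I * N * I)) * Nᵀ) * ((I * D) * (-(I * N * I)))) := by
        simp only [Matrix.mul_assoc]
    _ = -(Nᵀ * ((I * D) * (I * D)) * (-(I * N * I))) := by
        rw [h1, Matrix.mul_one]; simp only [Matrix.mul_assoc]
    _ = -(Nᵀ * ((I * I) * (D * D)) * (-(I * N * I))) := by
        congr 3
        calc (I * D) * (I * D) = (I * D) * (D * I) := by rw [← hcomm]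
          _ = I * (D * (D * I)) := by rw [Matrix.mul_assoc]
          _ = I * (D * (I * D)) := by rw [← hcomm]
          _ = I * ((D * I) * D) := by rw [Matrix.mul_assoc]
          _ = I * ((I * D) * D) := by rw [← hcomm]
          _ = (I * I) * (D * D) := by simp only [Matrix.mul_assoc]
    _ = _ := by rw [hII]; simp

theorem IsSymplecticSpectrum.trace_negSqJMul_pow {m : ℕ} {A : CMat m} {d : Fin m → ℝ}
    (h : IsSymplecticSpectrum A d) (q : ℕ) :
    trace (negSqJMul A ^ q) = 2 * ((∑ j, (d j ^ 2) ^ q : ℝ) : ℂ) := by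
  obtain ⟨P, Q, hQP, hPQ, hA⟩ := h.negSqJMul_similar
  have hpow : negSqJMul A ^ q =
      P * diagonal (fun p : Fin m × Fin 2 => ((d p.1 : ℂ) ^ 2) ^ q) * Q := by
    rw [hA]
    induction q with
    | zero => simp [hPQ]
    | succ q ih =>
      rw [pow_succ, ih]
      calc _ = P * (diagonal (fun p : Fin m × Fin 2 => ((d p.1 : ℂ) ^ 2) ^ q) *
            ((Q * P) * diagonal fun p : Fin m × Fin 2 => (d p.1 : ℂ) ^ 2)) * Q := by
            simp only [Matrix.mul_assoc]
        _ = _ := by rw [hQP, Matrix.one_mul, diagonal_mul_diagonal]; simp only [pow_succ]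
  rw [hpow, Matrix.trace_mul_comm, ← Matrix.mul_assoc, hQP, Matrix.one_mul, trace_diagonal,
    Fintype.sum_prod_type]
  simp [Finset.mul_sum, two_mul]

/-- Symplectic eigenvalues are at most the operator norm, since `J` is a contraction. -/
theorem IsSymplecticSpectrum.le_norm {m : ℕ} {A : CMat m} {d : Fin m → ℝ}
    (h : IsSymplecticSpectrum A d) (j : Fin m) : d j ≤ ‖A‖ := by
  obtain ⟨P, Q, hQP, hPQ, hA⟩ := h.negSqJMul_similar
  have hd := h.2.1 j
  have h1 : ‖negSqJMul A‖ ≤ ‖A‖ ^ 2 := by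
    have h2 : ‖complexJ m * A‖ ≤ ‖A‖ := by
      have := l2_opNorm_mul (complexJ m) A
      nlinarith [norm_complexJ_le m, norm_nonneg A]
    rw [negSqJMul, norm_neg, sq]
    exact (l2_opNorm_mul _ _).trans (mul_le_mul h2 h2 (norm_nonneg _) (norm_nonneg _))
  -- The column of `P` with index `(j, 0)` is an eigenvector for the eigenvalue `d j ^ 2`.
  set v : Fin m × Fin 2 → ℂ := P *ᵥ Pi.single (j, 0) 1 with hv
  have hv0 : v ≠ 0 := fun h0 => by
    have h2 : Q *ᵥ v = 0 := by rw [h0, mulVec_zero]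
    rw [hv, mulVec_mulVec, hQP, one_mulVec] at h2
    simpa using congrFun h2 (j, 0)
  have heig : negSqJMul A *ᵥ v = ((d j : ℂ) ^ 2) • v := by
    rw [hA, hv, mulVec_mulVec, Matrix.mul_assoc, hQP, Matrix.mul_one, ← mulVec_mulVec,
      ← mulVec_smul]
    congr 1
    ext p
    rw [mulVec_diagonal]
    by_cases hp : p = (j, 0)
    · subst hp; simp
    · simp [hp]
  have h2 := l2_opNorm_mulVec (negSqJMul A) (WithLp.toLp 2 v)
  have h3 : (WithLp.toLp 2 (negSqJMul A *ᵥ v) : EuclideanSpace ℂ (Fin m × Fin 2)) =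
      ((d j : ℂ) ^ 2) • WithLp.toLp 2 v := by rw [heig]; rfl
  have h4 : 0 < ‖(WithLp.toLp 2 v : EuclideanSpace ℂ (Fin m × Fin 2))‖ :=
    norm_pos_iff.2 fun h0 => hv0 (congrArg WithLp.ofLp h0)
  change ‖(WithLp.toLp 2 (negSqJMul A *ᵥ v) : EuclideanSpace ℂ (Fin m × Fin 2))‖ ≤ _ at h2
  rw [h3, norm_smul, norm_pow, Complex.norm_real, Real.norm_of_nonneg hd.le] at h2
  have h5 : d j ^ 2 ≤ ‖A‖ ^ 2 := (le_of_mul_le_mul_right h2 h4).trans h1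
  exact (sq_le_sq₀ hd.le (norm_nonneg _)).1 h5

end TraceFormula

/-! ### Scalar Toeplitz matrices: the defect of multiplicativity -/

section ScalarToeplitz

open AddCircle

variable {T : ℝ} [hT : Fact (0 < T)]

theorem fourierCoeff_mul_fourier (f : AddCircle T → ℂ) (l i : ℤ) :
    fourierCoeff (fun t => f t * fourier l t) i = fourierCoeff f (i - l) := by
  refine integral_congr_ae (Eventually.of_forall fun t => ?_)
  have : (-(i - l) : ℤ) = -i + l := by ring
  simp only [smul_eq_mul]
  rw [this, fourier_add]
  ring

/-- Parseval's identity for square integrable functions. -/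
theorem hasSum_sq_fourierCoeff_of_memLp {f : AddCircle T → ℂ} (hf : MemLp f 2 haarAddCircle) :
    HasSum (fun i => ‖fourierCoeff f i‖ ^ 2) (∫ t, ‖f t‖ ^ 2 ∂haarAddCircle) := by
  have h1 : fourierCoeff (hf.toLp f) = fourierCoeff f := fourierCoeff_congr_ae hf.coeFn_toLp
  have h2 : ∫ t, ‖hf.toLp f t‖ ^ 2 ∂haarAddCircle = ∫ t, ‖f t‖ ^ 2 ∂haarAddCircle :=
    integral_congr_ae (hf.coeFn_toLp.mono fun t ht => by simp only [ht])
  rw [← h1, ← h2]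
  exact hasSum_sq_fourierCoeff (hf.toLp f)

theorem memLp_fourier (l : ℤ) (p : ℝ≥0∞) :
    MemLp (fun t : AddCircle T => fourier l t) p haarAddCircle :=
  MemLp.of_bound (map_continuous (fourier l)).aestronglyMeasurable 1
    (Eventually.of_forall fun _ => (Circle.norm_coe _).le)

theorem memLp_top_mul {f g : AddCircle T → ℂ} {p : ℝ≥0∞} (hf : MemLp f ∞ haarAddCircle)
    (hg : MemLp g p haarAddCircle) : MemLp (fun t => f t * g t) p haarAddCircle :=
  hg.mul (p := ∞) hf

theorem memLp_two_of_top {f : AddCircle T → ℂ} (hf : MemLp f ∞ haarAddCircle) :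
    MemLp f 2 haarAddCircle := hf.mono_exponent le_top

theorem integrable_of_memLp_top {f : AddCircle T → ℂ} (hf : MemLp f ∞ haarAddCircle) :
    Integrable f haarAddCircle := hf.integrable le_top

theorem exists_ae_norm_le_of_memLp_top {f : AddCircle T → ℂ} (hf : MemLp f ∞ haarAddCircle) :
    ∃ K, ∀ᵐ t ∂haarAddCircle, ‖f t‖ ≤ K := ⟨_, ae_le_lpNorm_exponent_top hf⟩

/-- The defect `[∑ l < n, b̂ (i - l) ĉ (l - j)] - (bc)̂ (i - j)` in the multiplicativity of scalar
Toeplitz matrices. -/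
noncomputable def toeplitzDefect (b c : AddCircle T → ℂ) (n : ℕ) (i j : Fin n) : ℂ :=
  ∑ l : Fin n, fourierCoeff b ((i : ℤ) - l) * fourierCoeff c ((l : ℤ) - j) -
    fourierCoeff (fun t => b t * c t) ((i : ℤ) - j)

/-- The part of the function `c(t) eʲ(t)` with frequencies outside `[0, n)`. -/
noncomputable def outerPart (c : AddCircle T → ℂ) (n : ℕ) (j : Fin n) (t : AddCircle T) : ℂ :=
  c t * fourier (j : ℤ) t - ∑ l : Fin n, fourierCoeff c ((l : ℤ) - j) * fourier (l : ℤ) t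

theorem memLp_outerPart {c : AddCircle T → ℂ} (hc : MemLp c ∞ haarAddCircle) (n : ℕ) (j : Fin n) :
    MemLp (outerPart c n j) ∞ haarAddCircle := by
  refine (memLp_top_mul hc (memLp_fourier _ _)).sub ?_
  exact memLp_finsetSum (f := fun (l : Fin n) (t : AddCircle T) =>
    fourierCoeff c ((l : ℤ) - j) * fourier (l : ℤ) t) _ fun l _ => (memLp_fourier _ _).const_mul _

theorem fourierCoeff_mul_outerPart {b c : AddCircle T → ℂ} (hb : MemLp b ∞ haarAddCircle)
    (hc : MemLp c ∞ haarAddCircle) (n : ℕ) (j : Fin n) (i : ℤ) :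
    fourierCoeff (fun t => b t * outerPart c n j t) i =
      fourierCoeff (fun t => b t * c t) (i - j) -
        ∑ l : Fin n, fourierCoeff b (i - l) * fourierCoeff c ((l : ℤ) - j) := by
  have h1 : (fun t => b t * outerPart c n j t) =
      (fun t => (b t * c t) * fourier (j : ℤ) t) + ∑ l : Fin n,
        (fun t => (-fourierCoeff c ((l : ℤ) - j)) * (b t * fourier (l : ℤ) t)) := by
    ext t
    simp only [outerPart, Pi.add_apply, Finset.sum_apply, mul_sub, Finset.mul_sum, neg_mul,
      Finset.sum_neg_distrib]
    rw [sub_eq_add_neg]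
    congr 1
    · ring
    · congr 1
      exact Finset.sum_congr rfl fun l _ => by ring
  have hint : ∀ l : Fin n, Integrable
      (fun t => (-fourierCoeff c ((l : ℤ) - j)) * (b t * fourier (l : ℤ) t)) haarAddCircle :=
    fun l => (integrable_of_memLp_top (memLp_top_mul hb (memLp_fourier _ _))).const_mul _
  rw [h1, fourierCoeff.add
    (integrable_of_memLp_top (memLp_top_mul (memLp_top_mul hb hc) (memLp_fourier _ _)))
    (integrable_finsetSum' _ fun l _ => hint l), fourierCoeff.sum _ _ fun l _ => hint l]
  simp only [Pi.add_apply, Finset.sum_apply, fourierCoeff.const_mul, fourierCoeff_mul_fourier]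
  simp only [neg_mul, Finset.sum_neg_distrib, ← sub_eq_add_neg]
  congr 1
  exact Finset.sum_congr rfl fun l _ => mul_comm (_ : ℂ) _

theorem fourierCoeff_one (i : ℤ) :
    fourierCoeff (fun _ : AddCircle T => (1 : ℂ)) i = if i = 0 then 1 else 0 := by
  have h1 : fourierCoeff (fun _ : AddCircle T => (1 : ℂ)) i =
      fourierCoeff (@fourierLp T hT 2 _ 0) i := by
    rw [fourierCoeff_congr_ae (coeFn_fourierLp 2 0)]
    congr 1
    ext t
    simp
  rw [h1, ← coe_fourierBasis, ← fourierBasis_repr, HilbertBasis.repr_self]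
  simp [lp.single_apply, Pi.single_apply]

theorem fourierCoeff_outerPart {c : AddCircle T → ℂ} (hc : MemLp c ∞ haarAddCircle) (n : ℕ)
    (j : Fin n) (i : ℤ) :
    fourierCoeff (outerPart c n j) i =
      if i ∈ Finset.Ico (0 : ℤ) n then 0 else fourierCoeff c (i - j) := by
  have h := fourierCoeff_mul_outerPart (b := fun _ => 1) (memLp_const 1) hc n j i
  simp only [one_mul, fourierCoeff_one, sub_eq_zero] at h
  change fourierCoeff (fun t => outerPart c n j t) i = _
  rw [h]
  split_ifs with hi
  · rw [Finset.mem_Ico] at hi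
    obtain ⟨m, rfl⟩ := Int.eq_ofNat_of_zero_le hi.1
    rw [Finset.sum_eq_single (⟨m, by exact_mod_cast hi.2⟩ : Fin n)]
    · simp
    · intro l _ hl
      have : ¬ ((m : ℤ) = (l : ℤ)) := fun h => hl (Fin.ext (by simpa using h.symm))
      simp only [if_neg this, zero_mul]
    · simp
  · rw [Finset.sum_eq_zero, sub_zero]
    intro l _
    have : ¬ (i = (l : ℤ)) := by
      rintro rfl
      exact hi (Finset.mem_Ico.2 ⟨by positivity, by exact_mod_cast l.2⟩)
    simp only [if_neg this, zero_mul]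

/-- Parseval for `outerPart`: its squared norm is a tail of the Fourier series of `c`. -/
theorem integral_sq_outerPart {c : AddCircle T → ℂ} (hc : MemLp c ∞ haarAddCircle) (n : ℕ)
    (j : Fin n) :
    ∫ t, ‖outerPart c n j t‖ ^ 2 ∂haarAddCircle =
      (∫ t, ‖c t‖ ^ 2 ∂haarAddCircle) - ∑ l : Fin n, ‖fourierCoeff c ((l : ℤ) - j)‖ ^ 2 := by
  have h1 := hasSum_sq_fourierCoeff_of_memLp (memLp_two_of_top (memLp_outerPart hc n j))
  have h2 := (Equiv.subRight (j : ℤ)).hasSum_iff.2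
    (hasSum_sq_fourierCoeff_of_memLp (memLp_two_of_top hc))
  have h3 := h2.sub (hasSum_sum_of_ne_finset_zero
    (f := fun i => if i ∈ Finset.Ico (0 : ℤ) n then ‖fourierCoeff c (i - j)‖ ^ 2 else 0)
    (s := Finset.Ico (0 : ℤ) n) fun i hi => if_neg hi)
  have h4 : ∑ i ∈ Finset.Ico (0 : ℤ) n, (if i ∈ Finset.Ico (0 : ℤ) n then
      ‖fourierCoeff c (i - j)‖ ^ 2 else 0) = ∑ l : Fin n, ‖fourierCoeff c ((l : ℤ) - j)‖ ^ 2 := by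
    rw [Finset.sum_ite_mem, Finset.inter_self,
      Fin.sum_univ_eq_sum_range (fun l => ‖fourierCoeff c ((l : ℤ) - j)‖ ^ 2)]
    symm
    refine Finset.sum_bij (fun l _ => (l : ℤ)) ?_ ?_ ?_ ?_
    · intro l hl; simpa using hl
    · intro a _ b _ h; exact_mod_cast h
    · intro i hi
      rw [Finset.mem_Ico] at hi
      obtain ⟨m, rfl⟩ := Int.eq_ofNat_of_zero_le hi.1
      exact ⟨m, by simpa using hi.2, rfl⟩
    · intro l _; rfl
  rw [h4] at h3
  refine h1.unique (h3.congr_fun ?_)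
  intro i
  rw [fourierCoeff_outerPart hc]
  by_cases hi : i ∈ Finset.Ico (0 : ℤ) n
  · simp [hi, Equiv.subRight]
  · simp only [if_neg hi, sub_zero]
    rfl

/-- Bessel's inequality, applied to the columns of the defect. -/
theorem sum_sq_toeplitzDefect_le {b c : AddCircle T → ℂ} (hb : MemLp b ∞ haarAddCircle)
    (hc : MemLp c ∞ haarAddCircle) {K : ℝ} (hK : ∀ᵐ t ∂haarAddCircle, ‖b t‖ ≤ K) (n : ℕ)
    (j : Fin n) :
    ∑ i : Fin n, ‖toeplitzDefect b c n i j‖ ^ 2 ≤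
      K ^ 2 * ((∫ t, ‖c t‖ ^ 2 ∂haarAddCircle) -
        ∑ l : Fin n, ‖fourierCoeff c ((l : ℤ) - j)‖ ^ 2) := by
  have hmem := memLp_outerPart hc n j
  have hmem2 := memLp_two_of_top (memLp_top_mul hb hmem)
  have h1 := hasSum_sq_fourierCoeff_of_memLp hmem2
  have h2 : ∑ i : Fin n, ‖toeplitzDefect b c n i j‖ ^ 2 ≤
      ∫ t, ‖b t * outerPart c n j t‖ ^ 2 ∂haarAddCircle := by
    have h3 : ∀ i : Fin n, ‖toeplitzDefect b c n i j‖ ^ 2 =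
        ‖fourierCoeff (fun t => b t * outerPart c n j t) (i : ℤ)‖ ^ 2 := by
      intro i
      rw [fourierCoeff_mul_outerPart hb hc, toeplitzDefect, norm_sub_rev]
    let φ : Fin n ↪ ℤ := ⟨fun i => (i : ℤ), fun a b h => Fin.ext (by simpa using h)⟩
    have h4 := sum_le_hasSum (Finset.univ.map φ) (fun _ _ => by positivity) h1
    rw [Finset.sum_map] at h4
    simp only [h3]
    exact h4
  refine h2.trans ?_
  rw [← integral_sq_outerPart hc, ← integral_const_mul]
  refine integral_mono_ae hmem2.integrable_norm_pow'
    ((memLp_two_of_top hmem).integrable_norm_pow'.const_mul _) ?_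
  filter_upwards [hK] with t ht
  simp only [norm_mul, mul_pow]
  gcongr

/-- The defects of the multiplicativity of Toeplitz matrices are `o(√n)` in Frobenius norm: by
Parseval the squared Frobenius norm is at most a sum of tails of a convergent series, and the
Cesàro means of these tails vanish. -/
theorem tendsto_toeplitzDefect {b c : AddCircle T → ℂ} (hb : MemLp b ∞ haarAddCircle)
    (hc : MemLp c ∞ haarAddCircle) :
    Tendsto (fun n : ℕ => (n : ℝ)⁻¹ * ∑ j : Fin n, ∑ i : Fin n, ‖toeplitzDefect b c n i j‖ ^ 2)
      atTop (𝓝 0) := by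
  obtain ⟨K, hK⟩ : ∃ K, ∀ᵐ t ∂haarAddCircle, ‖b t‖ ≤ K :=

    exists_ae_norm_le_of_memLp_top hb
  set s : ℤ → ℝ := fun i => ‖fourierCoeff c i‖ ^ 2 with hs
  set S : ℝ := ∫ t, ‖c t‖ ^ 2 ∂haarAddCircle with hS
  have hsum : HasSum s S := hasSum_sq_fourierCoeff_of_memLp (memLp_two_of_top hc)
  -- The sum over `-j ≤ m < n - j` splits at `m = 0` into partial sums of two series.
  set p : ℕ → ℝ := fun a => ∑ m ∈ Finset.range a, s m with hp
  set q : ℕ → ℝ := fun a => ∑ m ∈ Finset.range a, s (-(m + 1)) with hq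
  have hsp : Summable fun m : ℕ => s m := hsum.summable.comp_injective Nat.cast_injective
  have hsq : Summable fun m : ℕ => s (-(m + 1)) :=
    hsum.summable.comp_injective (i := fun m : ℕ => -((m : ℤ) + 1))
      fun a b h => by simpa using h
  set P := ∑' m : ℕ, s m
  set Q := ∑' m : ℕ, s (-(m + 1))
  have hPQ : P + Q = S := (hsp.hasSum.of_nat_of_neg_add_one hsq.hasSum).unique hsum
  have hsplit : ∀ (n : ℕ) (j : Fin n), ∑ l : Fin n, s ((l : ℤ) - j) = p (n - j) + q j := by
    intro n j
    rw [Fin.sum_univ_eq_sum_range (fun l => s ((l : ℤ) - j))]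
    obtain ⟨j, hj⟩ := j
    obtain ⟨r, rfl⟩ := Nat.exists_eq_add_of_le hj.le
    rw [Nat.add_sub_cancel_left, hp, hq]
    simp only
    rw [Finset.sum_range_add, add_comm, ← Finset.sum_range_reflect (fun l => s ((l : ℤ) - j))]
    congr 1
    · refine Finset.sum_congr rfl fun m _ => ?_
      congr 1
      push_cast
      ring
    · refine Finset.sum_congr rfl fun m hm => ?_
      have := Finset.mem_range.1 hm
      congr 1
      omega
  have hrefl : ∀ n : ℕ, ∑ j : Fin n, p (n - j) = ∑ j ∈ Finset.range n, p (j + 1) := by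
    intro n
    rw [Fin.sum_univ_eq_sum_range (fun j => p (n - j)),
      ← Finset.sum_range_reflect (fun j => p (j + 1))]
    refine Finset.sum_congr rfl fun j hj => ?_
    have := Finset.mem_range.1 hj
    congr 1
    omega
  have hlim : Tendsto (fun n : ℕ => K ^ 2 * (S - ((n : ℝ)⁻¹ * ∑ j ∈ Finset.range n, p (j + 1) +
      (n : ℝ)⁻¹ * ∑ j ∈ Finset.range n, q j))) atTop (𝓝 0) := by
    have h1 := ((tendsto_add_atTop_iff_nat 1).2 hsp.hasSum.tendsto_sum_nat).cesaro
    have h2 := hsq.hasSum.tendsto_sum_nat.cesaro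
    have h3 := ((tendsto_const_nhds (x := S)).sub (h1.add h2)).const_mul (K ^ 2)
    rw [hPQ, sub_self, mul_zero] at h3
    exact h3
  refine squeeze_zero' (Eventually.of_forall fun n => by positivity) ?_ hlim
  filter_upwards [eventually_gt_atTop 0] with n hn
  have hn0 : (n : ℝ) ≠ 0 := by positivity
  have h1 : ∑ j : Fin n, ∑ i : Fin n, ‖toeplitzDefect b c n i j‖ ^ 2 ≤
      ∑ j : Fin n, K ^ 2 * (S - (p (n - j) + q j)) :=
    Finset.sum_le_sum fun j _ => by
      rw [← hsplit n j]
      exact sum_sq_toeplitzDefect_le hb hc hK n j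
  refine (mul_le_mul_of_nonneg_left h1 (by positivity)).trans (le_of_eq ?_)
  rw [← Finset.mul_sum, Finset.sum_sub_distrib, Finset.sum_add_distrib, hrefl,
    Fin.sum_univ_eq_sum_range q]
  simp only [Finset.sum_const, Finset.card_univ, Fintype.card_fin, nsmul_eq_mul]
  field_simp

end ScalarToeplitz

/-! ### Block Toeplitz matrices and their moments -/

section BlockToeplitz

open AddCircle Matrix
open scoped Matrix.Norms.L2Operator

variable {T : ℝ} [hT : Fact (0 < T)] {ι : Type*} [Fintype ι] [DecidableEq ι]

/-- A matrix symbol on the circle with measurable, essentially bounded entries. -/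
def IsBoundedSymbol (S : AddCircle T → Matrix ι ι ℂ) : Prop :=
  ∀ a b, MemLp (fun t => S t a b) ∞ haarAddCircle

/-- The `n × n` block Toeplitz matrix with symbol `S`, rows and columns being indexed by the number
of the block and the index inside the block. -/
noncomputable def blockToeplitz (S : AddCircle T → Matrix ι ι ℂ) (n : ℕ) :
    Matrix (Fin n × ι) (Fin n × ι) ℂ :=
  Matrix.of fun p q => fourierCoeff (fun t => S t p.2 q.2) ((p.1 : ℤ) - (q.1 : ℤ))

omit [DecidableEq ι] in
theorem IsBoundedSymbol.mul {S R : AddCircle T → Matrix ι ι ℂ} (hS : IsBoundedSymbol S)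
    (hR : IsBoundedSymbol R) : IsBoundedSymbol fun t => S t * R t := by
  intro a b
  simp only [Matrix.mul_apply]
  exact memLp_finsetSum (f := fun (c : ι) (t : AddCircle T) => S t a c * R t c b) _
    fun c _ => memLp_top_mul (hS a c) (hR c b)

omit [Fintype ι] [DecidableEq ι] in
theorem isBoundedSymbol_const (B : Matrix ι ι ℂ) :
    IsBoundedSymbol fun _ : AddCircle T => B := fun _ _ => memLp_const _

theorem IsBoundedSymbol.pow {S : AddCircle T → Matrix ι ι ℂ} (hS : IsBoundedSymbol S) (q : ℕ) :
    IsBoundedSymbol fun t => S t ^ q := by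
  induction q with
  | zero => simpa using isBoundedSymbol_const (T := T) (1 : Matrix ι ι ℂ)
  | succ q ih => simpa only [pow_succ] using ih.mul hS

omit [Fintype ι] in
theorem blockToeplitz_one (n : ℕ) :
    blockToeplitz (fun _ : AddCircle T => (1 : Matrix ι ι ℂ)) n = 1 := by
  ext ⟨i, a⟩ ⟨j, b⟩
  have h : (fun _ : AddCircle T => (1 : Matrix ι ι ℂ) a b) =
      fun _ => (1 : Matrix ι ι ℂ) a b * 1 := by simp
  simp only [blockToeplitz, of_apply]
  rw [h, fourierCoeff.const_mul, fourierCoeff_one]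
  simp only [sub_eq_zero, Matrix.one_apply, Prod.mk.injEq, Int.natCast_inj, Fin.val_inj]
  by_cases h1 : i = j <;> by_cases h2 : a = b <;> simp [h1, h2]

/-- The vector-valued trigonometric polynomial `∑ᵢ xᵢ eⁱ(t)` with coefficients `x`. -/
noncomputable def trigVec {n : ℕ} (x : Fin n × ι → ℂ) (t : AddCircle T) (a : ι) : ℂ :=
  ∑ i : Fin n, x (i, a) * fourier (i : ℤ) t

omit [DecidableEq ι] in
/-- The sesquilinear form of a block Toeplitz matrix is the integral of that of its symbol. -/
theorem dotProduct_blockToeplitz_mulVec {S : AddCircle T → Matrix ι ι ℂ} (hS : IsBoundedSymbol S)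
    {n : ℕ} (x y : Fin n × ι → ℂ) :
    star y ⬝ᵥ (blockToeplitz S n *ᵥ x) =
      ∫ t, star (trigVec y t) ⬝ᵥ (S t *ᵥ trigVec x t) ∂haarAddCircle := by
  have h : ∀ t : AddCircle T, star (trigVec y t) ⬝ᵥ (S t *ᵥ trigVec x t) =
      ∑ p : Fin n × ι, ∑ q : Fin n × ι, (star (y p) * x q) *
        (fourier (-((p.1 : ℤ) - (q.1 : ℤ))) t * S t p.2 q.2) := by
    intro t
    simp only [dotProduct, mulVec, trigVec, Fintype.sum_prod_type_right, Pi.star_apply, star_sum]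
    refine Finset.sum_congr rfl fun a _ => ?_
    rw [Finset.sum_mul]
    refine Finset.sum_congr rfl fun i _ => ?_
    rw [Finset.mul_sum]
    refine Finset.sum_congr rfl fun b _ => ?_
    rw [Finset.mul_sum, Finset.mul_sum]
    refine Finset.sum_congr rfl fun j _ => ?_
    rw [neg_sub, sub_eq_neg_add, fourier_add, fourier_neg, star_mul', starRingEnd_apply]
    ring
  simp only [h]
  have hint : ∀ p q : Fin n × ι, Integrable (fun t => (star (y p) * x q) *
        (fourier (-((p.1 : ℤ) - (q.1 : ℤ))) t * S t p.2 q.2)) haarAddCircle := fun p q =>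
    (((integrable_of_memLp_top (hS p.2 q.2)).fourier_smul _).const_mul _)
  rw [integral_finsetSum _ fun p _ => integrable_finsetSum _ fun q _ => hint p q]
  simp only [dotProduct, mulVec, Finset.mul_sum]
  refine Finset.sum_congr rfl fun p _ => ?_
  rw [integral_finsetSum _ fun q _ => hint p q]
  refine Finset.sum_congr rfl fun q _ => ?_
  rw [integral_const_mul]
  simp only [blockToeplitz, of_apply, fourierCoeff, smul_eq_mul, Pi.star_apply]
  ring

theorem star_dotProduct_self {κ : Type*} [Fintype κ] (v : κ → ℂ) :
    star v ⬝ᵥ v = ((∑ a, ‖v a‖ ^ 2 : ℝ) : ℂ) := by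
  simp only [dotProduct, Pi.star_apply, Complex.ofReal_sum, Complex.ofReal_pow]
  exact Finset.sum_congr rfl fun a _ => Complex.conj_mul' _

omit [Fintype ι] [DecidableEq ι] in
theorem memLp_trigVec {n : ℕ} (x : Fin n × ι → ℂ) (a : ι) :
    MemLp (fun t : AddCircle T => trigVec x t a) ∞ haarAddCircle :=
  memLp_finsetSum (f := fun (i : Fin n) (t : AddCircle T) => x (i, a) * fourier (i : ℤ) t) _
    fun _ _ => (memLp_fourier _ _).const_mul _

omit [DecidableEq ι] in
theorem integrable_sq_trigVec {n : ℕ} (x : Fin n × ι → ℂ) :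
    Integrable (fun t : AddCircle T => ∑ a, ‖trigVec x t a‖ ^ 2) haarAddCircle :=
  integrable_finsetSum _ fun a _ => (memLp_two_of_top (memLp_trigVec x a)).integrable_norm_pow'

theorem integral_sq_trigVec {n : ℕ} (x : Fin n × ι → ℂ) :
    ∫ t : AddCircle T, ∑ a, ‖trigVec x t a‖ ^ 2 ∂haarAddCircle = ∑ p, ‖x p‖ ^ 2 := by
  have h := dotProduct_blockToeplitz_mulVec (T := T) (isBoundedSymbol_const (1 : Matrix ι ι ℂ)) x x
  rw [blockToeplitz_one] at h
  simp only [one_mulVec, star_dotProduct_self] at h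
  rw [integral_complex_ofReal] at h
  exact_mod_cast h.symm

theorem sq_norm_toLp {κ : Type*} [Fintype κ] (v : κ → ℂ) :
    ‖(WithLp.toLp 2 v : EuclideanSpace ℂ κ)‖ ^ 2 = ∑ a, ‖v a‖ ^ 2 := by
  rw [EuclideanSpace.norm_sq_eq]

theorem norm_star_dotProduct_mulVec_le {κ : Type*} [Fintype κ] [DecidableEq κ] (B : Matrix κ κ ℂ)
    (v w : κ → ℂ) :
    ‖star w ⬝ᵥ (B *ᵥ v)‖ ≤ ‖B‖ * (2⁻¹ * (∑ a, ‖w a‖ ^ 2 + ∑ a, ‖v a‖ ^ 2)) := by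
  have h1 : star w ⬝ᵥ (B *ᵥ v) = inner ℂ (WithLp.toLp 2 w : EuclideanSpace ℂ κ)
      (WithLp.toLp 2 (B *ᵥ v)) := by
    rw [EuclideanSpace.inner_eq_star_dotProduct, dotProduct_comm]
  have h2 : ‖(WithLp.toLp 2 (B *ᵥ v) : EuclideanSpace ℂ κ)‖ ≤ _ :=
    l2_opNorm_mulVec B (WithLp.toLp 2 v)
  rw [← sq_norm_toLp, ← sq_norm_toLp, h1]
  refine (norm_inner_le_norm _ _).trans ?_
  set α := ‖(WithLp.toLp 2 w : EuclideanSpace ℂ κ)‖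
  set β := ‖(WithLp.toLp 2 v : EuclideanSpace ℂ κ)‖
  calc _ ≤ α * (‖B‖ * β) := by gcongr
    _ = ‖B‖ * (α * β) := by ring
    _ ≤ _ := by
      refine mul_le_mul_of_nonneg_left ?_ (norm_nonneg _)
      nlinarith [sq_nonneg (α - β)]

/-- The operator norm of a block Toeplitz matrix is at most the essential supremum of the operator
norm of its symbol. -/
theorem norm_blockToeplitz_le {S : AddCircle T → Matrix ι ι ℂ} (hS : IsBoundedSymbol S) {K : ℝ}
    (hK0 : 0 ≤ K) (hK : ∀ᵐ t ∂haarAddCircle, ‖S t‖ ≤ K) (n : ℕ) : ‖blockToeplitz S n‖ ≤ K := by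
  have key : ∀ x y : Fin n × ι → ℂ, ‖star y ⬝ᵥ (blockToeplitz S n *ᵥ x)‖ ≤
      K * (2⁻¹ * (∑ p, ‖y p‖ ^ 2 + ∑ p, ‖x p‖ ^ 2)) := by
    intro x y
    rw [dotProduct_blockToeplitz_mulVec hS, ← integral_sq_trigVec (T := T) x,
      ← integral_sq_trigVec (T := T) y,
      ← integral_add (integrable_sq_trigVec y) (integrable_sq_trigVec x), ← integral_const_mul,
      ← integral_const_mul]
    refine norm_integral_le_of_norm_le
      ((((integrable_sq_trigVec y).add (integrable_sq_trigVec x)).const_mul _).const_mul _) ?_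
    filter_upwards [hK] with t ht
    exact (norm_star_dotProduct_mulVec_le _ _ _).trans
      (mul_le_mul_of_nonneg_right ht (by positivity))
  rw [← l2_opNorm_toEuclideanCLM]
  refine ContinuousLinearMap.opNorm_le_bound _ hK0 fun x => ?_
  set z : Fin n × ι → ℂ := blockToeplitz S n *ᵥ x.ofLp with hz
  have hz' : toEuclideanCLM (n := Fin n × ι) (𝕜 := ℂ) (blockToeplitz S n) x = WithLp.toLp 2 z := rfl
  rw [hz']
  set Z := ‖(WithLp.toLp 2 z : EuclideanSpace ℂ (Fin n × ι))‖ with hZ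
  have hx : ∑ p, ‖x.ofLp p‖ ^ 2 = ‖x‖ ^ 2 := (sq_norm_toLp x.ofLp).symm
  -- Testing against the multiple `r z` of the image.
  have hr : ∀ r : ℝ, 0 ≤ r → r * Z ^ 2 ≤ K * (2⁻¹ * (r ^ 2 * Z ^ 2 + ‖x‖ ^ 2)) := by
    intro r hr
    have h := key x.ofLp ((r : ℂ) • z)
    have h1 : star ((r : ℂ) • z) ⬝ᵥ (blockToeplitz S n *ᵥ x.ofLp) = ((r * Z ^ 2 : ℝ) : ℂ) := by
      rw [← hz, star_smul, smul_dotProduct, star_dotProduct_self, hZ, sq_norm_toLp]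
      simp
    have h2 : ∑ p, ‖((r : ℂ) • z) p‖ ^ 2 = r ^ 2 * Z ^ 2 := by
      rw [hZ, sq_norm_toLp, Finset.mul_sum]
      refine Finset.sum_congr rfl fun p _ => ?_
      rw [Pi.smul_apply, norm_smul, Complex.norm_real, mul_pow, Real.norm_eq_abs, sq_abs]
    rw [h1, h2, hx, Complex.norm_real, Real.norm_of_nonneg (by positivity)] at h
    exact h
  refine abs_le_of_sq_le_sq' ?_ (by positivity) |>.2
  rcases hK0.eq_or_lt with h0 | h0
  · have := hr 1 zero_le_one
    rw [← h0] at this ⊢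
    nlinarith
  · have := hr K⁻¹ (by positivity)
    have h2 : K * (2⁻¹ * (K⁻¹ ^ 2 * Z ^ 2 + ‖x‖ ^ 2)) =
        2⁻¹ * (K⁻¹ * Z ^ 2) + 2⁻¹ * (K * ‖x‖ ^ 2) := by
      field_simp
    rw [h2] at this
    have h3 : K⁻¹ * Z ^ 2 ≤ K * ‖x‖ ^ 2 := by linarith
    rw [inv_mul_le_iff₀ h0] at h3
    linarith [h3, mul_pow K ‖x‖ 2, mul_assoc K K (‖x‖ ^ 2), sq K]

theorem norm_le_sum_norm_entries : ∃ C : ℝ, 0 ≤ C ∧ ∀ B : Matrix ι ι ℂ,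
    ‖B‖ ≤ C * ∑ a, ∑ b, ‖B a b‖ := by
  refine ⟨∑ a : ι, ∑ b : ι, ‖(single a b (1 : ℂ) : Matrix ι ι ℂ)‖, by positivity, fun B => ?_⟩
  conv_lhs => rw [matrix_eq_sum_single B]
  refine (norm_sum_le _ _).trans ?_
  rw [Finset.mul_sum]
  refine Finset.sum_le_sum fun a _ => (norm_sum_le _ _).trans ?_
  rw [Finset.mul_sum]
  refine Finset.sum_le_sum fun b _ => ?_
  have : single a b (B a b) = B a b • (single a b (1 : ℂ) : Matrix ι ι ℂ) := by simp
  rw [this, norm_smul, mul_comm]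
  gcongr
  exact (Finset.single_le_sum (f := fun b => ‖(single a b (1 : ℂ) : Matrix ι ι ℂ)‖)
    (fun _ _ => norm_nonneg _) (Finset.mem_univ b)).trans
    (Finset.single_le_sum (f := fun a => ∑ b, ‖(single a b (1 : ℂ) : Matrix ι ι ℂ)‖)
    (fun _ _ => Finset.sum_nonneg fun _ _ => norm_nonneg _) (Finset.mem_univ a))

theorem IsBoundedSymbol.exists_ae_norm_le {S : AddCircle T → Matrix ι ι ℂ}
    (hS : IsBoundedSymbol S) : ∃ K, 0 ≤ K ∧ ∀ᵐ t ∂haarAddCircle, ‖S t‖ ≤ K := by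
  obtain ⟨C, hC0, hC⟩ := norm_le_sum_norm_entries (ι := ι)
  choose k hk using fun a b => exists_ae_norm_le_of_memLp_top (hS a b)
  refine ⟨C * ∑ a, ∑ b, |k a b|, by positivity, ?_⟩
  filter_upwards [ae_all_iff.2 fun a => ae_all_iff.2 fun b => hk a b] with t ht
  refine (hC _).trans (mul_le_mul_of_nonneg_left ?_ hC0)
  exact Finset.sum_le_sum fun a _ => Finset.sum_le_sum fun b _ => (ht a b).trans (le_abs_self _)

/-- A sequence of `n`-block matrices is negligible when its Frobenius norm is `o(√n)`. -/
def IsNegligible (X : ∀ n : ℕ, Matrix (Fin n × ι) (Fin n × ι) ℂ) : Prop :=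
  Tendsto (fun n : ℕ => (n : ℝ)⁻¹ * ∑ q, ∑ p, ‖X n p q‖ ^ 2) atTop (𝓝 0)

omit [DecidableEq ι] in
theorem IsNegligible.add {X Y : ∀ n : ℕ, Matrix (Fin n × ι) (Fin n × ι) ℂ} (hX : IsNegligible X)
    (hY : IsNegligible Y) : IsNegligible fun n => X n + Y n := by
  have h := (hX.const_mul 2).add (hY.const_mul 2)
  rw [mul_zero, add_zero] at h
  refine squeeze_zero (fun n => by positivity) (fun n => ?_) h
  rw [mul_left_comm, mul_left_comm 2, ← mul_add]
  refine mul_le_mul_of_nonneg_left ?_ (by positivity)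
  simp only [Finset.mul_sum, ← Finset.sum_add_distrib]
  refine Finset.sum_le_sum fun q _ => Finset.sum_le_sum fun p _ => ?_
  have h1 := norm_add_le (X n p q) (Y n p q)
  rw [Matrix.add_apply]
  nlinarith [sq_nonneg (‖X n p q‖ - ‖Y n p q‖), norm_nonneg (X n p q + Y n p q)]

theorem IsNegligible.mul_left {X B : ∀ n : ℕ, Matrix (Fin n × ι) (Fin n × ι) ℂ}
    (hX : IsNegligible X) {K : ℝ} (hB : ∀ n, ‖B n‖ ≤ K) : IsNegligible fun n => B n * X n := by
  have h := hX.const_mul (K ^ 2)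
  rw [mul_zero] at h
  refine squeeze_zero (fun n => by positivity) (fun n => ?_) h
  rw [mul_left_comm]
  refine mul_le_mul_of_nonneg_left ?_ (by positivity)
  rw [Finset.mul_sum]
  refine Finset.sum_le_sum fun q _ => ?_
  have h1 : ‖(WithLp.toLp 2 (B n *ᵥ fun p => X n p q) : EuclideanSpace ℂ (Fin n × ι))‖ ≤ _ :=
    l2_opNorm_mulVec (B n) (WithLp.toLp 2 fun p => X n p q)
  rw [← sq_norm_toLp fun p => X n p q, ← mul_pow]
  calc ∑ p, ‖(B n * X n) p q‖ ^ 2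
      = ‖(WithLp.toLp 2 (B n *ᵥ fun p => X n p q) : EuclideanSpace ℂ (Fin n × ι))‖ ^ 2 := by
        rw [sq_norm_toLp]; rfl
    _ ≤ _ := by
        refine pow_le_pow_left₀ (norm_nonneg _) (h1.trans ?_) 2
        gcongr
        exact hB n

omit [DecidableEq ι] in
theorem IsNegligible.tendsto_trace {X : ∀ n : ℕ, Matrix (Fin n × ι) (Fin n × ι) ℂ}
    (hX : IsNegligible X) : Tendsto (fun n : ℕ => (n : ℂ)⁻¹ * trace (X n)) atTop (𝓝 0) := by
  have h := (hX.const_mul (Fintype.card ι : ℝ)).sqrt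
  rw [mul_zero, Real.sqrt_zero] at h
  refine squeeze_zero_norm (fun n => Real.le_sqrt_of_sq_le ?_) h
  have h1 : ‖trace (X n)‖ ^ 2 ≤ (n * Fintype.card ι : ℝ) * ∑ p, ‖X n p p‖ ^ 2 := by
    have h2 : ‖trace (X n)‖ ≤ ∑ p, ‖X n p p‖ := norm_sum_le _ _
    have h3 := sq_sum_le_card_mul_sum_sq (s := Finset.univ) (f := fun p => ‖X n p p‖)
    simp only [Finset.card_univ, Fintype.card_prod, Fintype.card_fin, Nat.cast_mul] at h3
    exact (pow_le_pow_left₀ (norm_nonneg _) h2 2).trans h3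
  have h2 : ∑ p, ‖X n p p‖ ^ 2 ≤ ∑ q, ∑ p, ‖X n p q‖ ^ 2 :=
    Finset.sum_le_sum fun q _ => Finset.single_le_sum (f := fun p => ‖X n p q‖ ^ 2)
      (fun _ _ => by positivity) (Finset.mem_univ q)
  rw [norm_mul, mul_pow, norm_inv, Complex.norm_natCast]
  rcases Nat.eq_zero_or_pos n with rfl | hn
  · simp
  have hn0 : (n : ℝ) ≠ 0 := by positivity
  calc ((n : ℝ)⁻¹) ^ 2 * ‖trace (X n)‖ ^ 2
      ≤ ((n : ℝ)⁻¹) ^ 2 * ((n * Fintype.card ι : ℝ) * ∑ q, ∑ p, ‖X n p q‖ ^ 2) := by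
        refine mul_le_mul_of_nonneg_left (h1.trans ?_) (by positivity)
        exact mul_le_mul_of_nonneg_left h2 (by positivity)
    _ = _ := by field_simp

omit [DecidableEq ι] in
/-- Block Toeplitz matrices multiply like their symbols, up to a negligible error. -/
theorem isNegligible_blockToeplitz_mul_sub {S R : AddCircle T → Matrix ι ι ℂ}
    (hS : IsBoundedSymbol S) (hR : IsBoundedSymbol R) :
    IsNegligible fun n => blockToeplitz S n * blockToeplitz R n -
      blockToeplitz (fun t => S t * R t) n := by
  have hentry : ∀ (n : ℕ) (p q : Fin n × ι), (blockToeplitz S n * blockToeplitz R n -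
      blockToeplitz (fun t => S t * R t) n) p q =
        ∑ c, toeplitzDefect (fun t => S t p.2 c) (fun t => R t c q.2) n p.1 q.1 := by
    intro n p q
    have h1 : (fun t => (S t * R t) p.2 q.2) = ∑ c, fun t => S t p.2 c * R t c q.2 := by
      ext t
      simp [Matrix.mul_apply]
    simp only [Matrix.sub_apply, Matrix.mul_apply, blockToeplitz, of_apply, toeplitzDefect,
      Finset.sum_sub_distrib, Fintype.sum_prod_type]
    simp only [← Matrix.mul_apply]
    rw [h1, fourierCoeff.sum _ _ fun c _ =>
      integrable_of_memLp_top (memLp_top_mul (hS p.2 c) (hR c q.2)), Finset.sum_comm,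
      Finset.sum_apply]
  have hlim : Tendsto (fun n : ℕ => ∑ b : ι, ∑ a : ι, ∑ c : ι, (Fintype.card ι : ℝ) *
      ((n : ℝ)⁻¹ * ∑ j : Fin n, ∑ i : Fin n,
        ‖toeplitzDefect (fun t => S t a c) (fun t => R t c b) n i j‖ ^ 2)) atTop (𝓝 0) := by
    have h := tendsto_finsetSum (Finset.univ : Finset ι) fun b _ =>
      tendsto_finsetSum (Finset.univ : Finset ι) fun a _ =>
      tendsto_finsetSum (Finset.univ : Finset ι) fun c _ =>
        (tendsto_toeplitzDefect (hS a c) (hR c b)).const_mul (Fintype.card ι : ℝ)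
    simpa only [mul_zero, Finset.sum_const_zero] using h
  refine squeeze_zero (fun n => by positivity) (fun n => ?_) hlim
  simp only [hentry]
  have h1 : ∀ p q : Fin n × ι,
      ‖∑ c, toeplitzDefect (fun t => S t p.2 c) (fun t => R t c q.2) n p.1 q.1‖ ^ 2 ≤
      Fintype.card ι *
        ∑ c, ‖toeplitzDefect (fun t => S t p.2 c) (fun t => R t c q.2) n p.1 q.1‖ ^ 2 := by
    intro p q
    refine (pow_le_pow_left₀ (norm_nonneg _) (norm_sum_le _ _) 2).trans ?_
    simpa using sq_sum_le_card_mul_sum_sq (s := Finset.univ)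
      (f := fun c => ‖toeplitzDefect (fun t => S t p.2 c) (fun t => R t c q.2) n p.1 q.1‖)
  refine (mul_le_mul_of_nonneg_left (Finset.sum_le_sum fun q _ => Finset.sum_le_sum fun p _ =>
    h1 p q) (by positivity)).trans (le_of_eq ?_)
  simp only [Fintype.sum_prod_type_right, Finset.mul_sum]
  refine Finset.sum_congr rfl fun b _ => ?_
  rw [Finset.sum_comm]
  refine Finset.sum_congr rfl fun a _ => ?_
  rw [Finset.sum_comm (s := (Finset.univ : Finset ι))]
  refine Finset.sum_congr rfl fun j _ => ?_
  rw [Finset.sum_comm]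
  refine Finset.sum_congr rfl fun c _ => Finset.sum_congr rfl fun i _ => ?_
  ring

theorem isNegligible_blockToeplitz_pow_sub {S : AddCircle T → Matrix ι ι ℂ}
    (hS : IsBoundedSymbol S) (q : ℕ) :
    IsNegligible fun n => blockToeplitz S n ^ q - blockToeplitz (fun t => S t ^ q) n := by
  induction q with
  | zero =>
    simp only [pow_zero, blockToeplitz_one, sub_self]
    simp [IsNegligible]
  | succ q ih =>
    obtain ⟨K, hK0, hK⟩ := hS.exists_ae_norm_le
    have h := (ih.mul_left (norm_blockToeplitz_le hS hK0 hK)).add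
      (isNegligible_blockToeplitz_mul_sub hS (hS.pow q))
    simp only [pow_succ']
    convert h using 2 with n
    rw [mul_sub, sub_add_sub_cancel]

/-- **Szegő's limit theorem for moments**: the normalized traces of the powers of the block Toeplitz
matrices of a bounded (not necessarily Hermitian) symbol. -/
theorem tendsto_trace_blockToeplitz_pow {S : AddCircle T → Matrix ι ι ℂ} (hS : IsBoundedSymbol S)
    (q : ℕ) : Tendsto (fun n : ℕ => (n : ℂ)⁻¹ * trace (blockToeplitz S n ^ q)) atTop
      (𝓝 (∫ t, trace (S t ^ q) ∂haarAddCircle)) := by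
  have h := (isNegligible_blockToeplitz_pow_sub hS q).tendsto_trace.add_const
    (∫ t, trace (S t ^ q) ∂haarAddCircle)
  rw [zero_add] at h
  refine h.congr' ?_
  filter_upwards [eventually_gt_atTop 0] with n hn
  have hn0 : (n : ℂ) ≠ 0 := by exact_mod_cast hn.ne'
  have h1 : trace (blockToeplitz (fun t => S t ^ q) n) =
      n * ∫ t, trace (S t ^ q) ∂haarAddCircle := by
    simp only [trace, diag_apply, blockToeplitz, of_apply, Fintype.sum_prod_type, sub_self]
    rw [integral_finsetSum _ fun a _ => integrable_of_memLp_top (hS.pow q a a)]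
    simp [fourierCoeff]
  rw [trace_sub, h1, mul_sub, inv_mul_cancel_left₀ hn0, sub_add_cancel]

end BlockToeplitz

/-! ### Lower bounds of multiplication operators -/

section FourierPositivity

open AddCircle

variable {T : ℝ} [hT : Fact (0 < T)]

/-- Essentially bounded functions with the same Fourier coefficients agree almost everywhere. -/
theorem ae_eq_of_fourierCoeff_eq {f g : AddCircle T → ℂ} (hf : MemLp f ∞ haarAddCircle)
    (hg : MemLp g ∞ haarAddCircle) (h : ∀ n, fourierCoeff f n = fourierCoeff g n) :
    f =ᵐ[haarAddCircle] g := by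
  have hf2 := memLp_two_of_top hf
  have hg2 := memLp_two_of_top hg
  have h1 : hf2.toLp f = hg2.toLp g := by
    refine (@fourierBasis T hT).repr.injective (lp.ext (funext fun i => ?_))
    rw [fourierBasis_repr, fourierBasis_repr, fourierCoeff_congr_ae hf2.coeFn_toLp,
      fourierCoeff_congr_ae hg2.coeFn_toLp, h]
  exact (MemLp.toLp_eq_toLp_iff hf2 hg2).1 h1

theorem fourierCoeff_star (f : AddCircle T → ℂ) (n : ℤ) :
    fourierCoeff (fun t => star (f t)) n = star (fourierCoeff f (-n)) := by
  simp only [fourierCoeff, smul_eq_mul]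
  rw [RCLike.star_def, ← integral_conj]
  refine integral_congr_ae (Eventually.of_forall fun t => ?_)
  simp only [neg_neg, map_mul, ← fourier_neg]

/-- A bounded function whose Toeplitz form is bounded below by `κ` is itself bounded below by `κ`:
by density the quadratic form of the multiplication operator on `L²` is bounded below by `κ`, and it
is tested on indicator functions. -/
theorem ae_le_re_of_toeplitz_form_ge {φ : AddCircle T → ℂ} (hφ : MemLp φ ∞ haarAddCircle) {κ : ℝ}
    (h : ∀ (s : Finset ℤ) (w : ℤ → ℂ), κ * ∑ i ∈ s, ‖w i‖ ^ 2 ≤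
      (∑ i ∈ s, ∑ j ∈ s, star (w i) * w j * fourierCoeff φ (i - j)).re) :
    ∀ᵐ t ∂haarAddCircle, κ ≤ (φ t).re := by
  set Φ : Lp ℂ ∞ (@haarAddCircle T hT) := hφ.toLp φ with hΦ
  set M : Lp ℂ 2 (@haarAddCircle T hT) →L[ℂ] Lp ℂ 2 (@haarAddCircle T hT) :=
    (ContinuousLinearMap.mul ℂ ℂ).holderL haarAddCircle ∞ 2 2 Φ with hM
  have hMapp : ∀ g : Lp ℂ 2 (@haarAddCircle T hT), M g =ᵐ[haarAddCircle] fun t => φ t * g t := by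
    intro g
    have h1 := (ContinuousLinearMap.mul ℂ ℂ).coeFn_holder (r := 2) Φ g
    filter_upwards [h1, hφ.coeFn_toLp] with t ht1 ht2
    change ((ContinuousLinearMap.mul ℂ ℂ).holder 2 Φ g) t = _
    rw [ht1, ContinuousLinearMap.mul_apply', hΦ, ht2]
  have hbasis : ∀ i j : ℤ, inner ℂ (@fourierLp T hT 2 _ i) (M (fourierLp 2 j)) =
      fourierCoeff φ (i - j) := by
    intro i j
    rw [← coe_fourierBasis, ← HilbertBasis.repr_apply_apply, fourierBasis_repr, coe_fourierBasis,
      ← fourierCoeff_mul_fourier]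
    refine congrFun (fourierCoeff_congr_ae ?_) i
    filter_upwards [hMapp (fourierLp 2 j), coeFn_fourierLp 2 j] with t ht1 ht2
    rw [ht1, ht2]
  have hL2 : ∀ g : Lp ℂ 2 (@haarAddCircle T hT), κ * ‖g‖ ^ 2 ≤ (inner ℂ g (M g)).re := by
    intro g
    have hlim := hasSum_fourier_series_L2 g
    have h1 : Tendsto (fun s : Finset ℤ => κ * ‖∑ i ∈ s, fourierCoeff g i • fourierLp 2 i‖ ^ 2)
        atTop (𝓝 (κ * ‖g‖ ^ 2)) := (hlim.norm.pow 2).const_mul κ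
    have h2 : Tendsto (fun s : Finset ℤ => (inner ℂ (∑ i ∈ s, fourierCoeff g i • fourierLp 2 i)
        (M (∑ i ∈ s, fourierCoeff g i • fourierLp 2 i))).re) atTop (𝓝 (inner ℂ g (M g)).re) :=
      (Complex.continuous_re.tendsto _).comp
        (Filter.Tendsto.inner hlim ((M.continuous.tendsto g).comp hlim))
    refine le_of_tendsto_of_tendsto' h1 h2 fun s => ?_
    have h3 := h s (fourierCoeff g)
    have h4 : ‖∑ i ∈ s, fourierCoeff g i • @fourierLp T hT 2 _ i‖ ^ 2 =
        ∑ i ∈ s, ‖fourierCoeff g i‖ ^ 2 := by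
      have h5 := (orthonormal_fourier (T := T)).inner_sum (fourierCoeff g) (fourierCoeff g) s
      have h6 : ∀ i ∈ s, (starRingEnd ℂ) (fourierCoeff g i) * fourierCoeff g i =
        ((‖fourierCoeff g i‖ ^ 2 : ℝ) : ℂ) := fun i _ => by
          rw [Complex.conj_mul']; norm_cast
      rw [Finset.sum_congr rfl h6, ← Complex.ofReal_sum] at h5
      have h7 := congrArg Complex.re h5
      rw [Complex.ofReal_re] at h7
      rw [← h7]
      exact (inner_self_eq_norm_sq (𝕜 := ℂ) _).symm
    rw [h4]
    refine h3.trans (le_of_eq ?_)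
    congr 1
    simp only [map_sum, map_smul, sum_inner, inner_sum, inner_smul_left, inner_smul_right, hbasis,
      RCLike.star_def]
    rw [Finset.sum_comm]
    refine Finset.sum_congr rfl fun i _ => ?_
    rw [Finset.mul_sum]
    exact Finset.sum_congr rfl fun j _ => by ring
  have hint : Integrable (fun t => (φ t).re) haarAddCircle := (integrable_of_memLp_top hφ).re
  refine ae_le_of_forall_setIntegral_le (integrable_const κ) hint fun E hE _ => ?_
  set g : Lp ℂ 2 (@haarAddCircle T hT) := indicatorConstLp 2 hE (measure_ne_top _ _) 1 with hg
  have h1 := hL2 g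
  have h2 : inner ℂ g (M g) = ∫ t in E, φ t ∂haarAddCircle := by
    rw [hg, L2.inner_indicatorConstLp_one]
    refine setIntegral_congr_ae hE ?_
    filter_upwards [hMapp g, indicatorConstLp_coeFn (p := 2) (hs := hE)
      (hμs := measure_ne_top (@haarAddCircle T hT) E) (c := (1 : ℂ))] with t ht1 ht2 htE
    rw [ht1, hg, ht2, indicator_of_mem htE, mul_one]
  have h3 : ‖g‖ ^ 2 = (haarAddCircle : Measure (AddCircle T)).real E := by
    rw [hg, norm_indicatorConstLp two_ne_zero ENNReal.ofNat_ne_top]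
    rw [norm_one, one_mul, ENNReal.toReal_ofNat, ← Real.sqrt_eq_rpow,
      Real.sq_sqrt measureReal_nonneg]
  rw [h2, h3] at h1
  rw [setIntegral_const, smul_eq_mul, mul_comm]
  refine h1.trans (le_of_eq ?_)
  exact (integral_re (integrable_of_memLp_top hφ).integrableOn).symm

end FourierPositivity

/-! ### Quadratic forms of block Toeplitz operators -/

section ToeplitzOperator

open Matrix
open scoped ComplexOrder

/-- A positive invertible operator on a Hilbert space is bounded below. -/
theorem exists_pos_mul_sq_norm_le {H : Type*} [NormedAddCommGroup H] [InnerProductSpace ℂ H]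
    [CompleteSpace H] {A : H →L[ℂ] H} (hA : IsPositiveInvertible A) :
    ∃ c : ℝ, 0 < c ∧ ∀ x, c * ‖x‖ ^ 2 ≤ (inner ℂ x (A x)).re := by
  have hnn : (0 : H →L[ℂ] H) ≤ A := (ContinuousLinearMap.nonneg_iff_isPositive A).2 hA.1
  obtain ⟨b, hb, rfl⟩ := CStarAlgebra.isStrictlyPositive_iff_eq_star_mul_self.1
    (hA.2.2.isStrictlyPositive hnn)
  obtain ⟨u, rfl⟩ := hb
  set v : H →L[ℂ] H := ↑u⁻¹ with hv
  refine ⟨((‖v‖ + 1) ^ 2)⁻¹, by positivity, fun x => ?_⟩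
  have h1 : (inner ℂ x ((star (u : H →L[ℂ] H) * u) x)).re = ‖(u : H →L[ℂ] H) x‖ ^ 2 := by
    change (inner ℂ x (star (u : H →L[ℂ] H) ((u : H →L[ℂ] H) x))).re = _
    rw [ContinuousLinearMap.star_eq_adjoint, ContinuousLinearMap.adjoint_inner_right]
    exact inner_self_eq_norm_sq (𝕜 := ℂ) _
  have h2 : v ((u : H →L[ℂ] H) x) = x :=
    congrArg (fun B : H →L[ℂ] H => B x) u.inv_mul
  have h3 : ‖x‖ ≤ (‖v‖ + 1) * ‖(u : H →L[ℂ] H) x‖ := by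
    calc ‖x‖ = ‖v ((u : H →L[ℂ] H) x)‖ := by rw [h2]
      _ ≤ ‖v‖ * ‖(u : H →L[ℂ] H) x‖ := v.le_opNorm _
      _ ≤ _ := by gcongr; linarith
  rw [h1, inv_mul_le_iff₀ (by positivity), ← mul_pow]
  gcongr

variable {k : ℕ}

/-- The standard basis sequence of `l²_{2k}` with a single entry `1`, at place `a` of the vector
number `i`. -/
noncomputable def basisSeq (i : ℕ) (a : Fin k × Fin 2) : L2Seq k :=
  lp.single 2 i (EuclideanSpace.single a (1 : ℂ))

theorem inner_basisSeq (i : ℕ) (a : Fin k × Fin 2) (x : L2Seq k) :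
    inner ℂ (basisSeq i a) x = x i a := by
  rw [basisSeq, lp.inner_single_left, EuclideanSpace.inner_single_left, map_one, one_mul]

theorem inner_basisSeq_basisSeq (i j : ℕ) (a b : Fin k × Fin 2) :
    inner ℂ (basisSeq i a) (basisSeq j b) = if i = j ∧ a = b then (1 : ℂ) else 0 := by
  rw [inner_basisSeq, basisSeq, lp.single_apply]
  by_cases h : i = j
  · subst h
    simp
  · simp [h]

/-- A lower bound of a block Toeplitz operator, tested on a combination of finitely many distinct
basis sequences. The family is arbitrary, so that it can consist of the basis of a truncation, or of
the frequencies of a trigonometric polynomial shifted to be nonnegative. -/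
theorem re_form_ge_of_isGeneratedBy {A : ℝ → CMat k} {T : L2Seq k →L[ℂ] L2Seq k}
    (hT : IsGeneratedBy T A) {c : ℝ} (hc : ∀ x, c * ‖x‖ ^ 2 ≤ (inner ℂ x (T x)).re)
    {α : Type*} [DecidableEq α] (s : Finset α) (f : α → ℕ) (g : α → Fin k × Fin 2)
    (hfg : ∀ p ∈ s, ∀ q ∈ s, f p = f q ∧ g p = g q → p = q) (x : α → ℂ) :
    c * ∑ p ∈ s, ‖x p‖ ^ 2 ≤ (∑ p ∈ s, ∑ q ∈ s, star (x p) * x q *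
      fourierBlock A ((f p : ℤ) - f q) (g p) (g q)).re := by
  have h := hc (∑ p ∈ s, x p • basisSeq (f p) (g p))
  have h1 : ‖∑ p ∈ s, x p • basisSeq (f p) (g p)‖ ^ 2 = ∑ p ∈ s, ‖x p‖ ^ 2 := by
    have h2 : inner ℂ (∑ p ∈ s, x p • basisSeq (f p) (g p)) (∑ p ∈ s, x p • basisSeq (f p) (g p)) =
        ((∑ p ∈ s, ‖x p‖ ^ 2 : ℝ) : ℂ) := by
      simp only [sum_inner, inner_sum, inner_smul_left, inner_smul_right, inner_basisSeq_basisSeq,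
        Complex.ofReal_sum]
      refine Finset.sum_congr rfl fun p hp => ?_
      rw [Finset.sum_eq_single p]
      · simp [Complex.mul_conj']
      · intro q hq hqp
        rw [if_neg fun h => hqp (hfg q hq p hp h)]
        simp
      · exact fun h => absurd hp h
    have h3 := congrArg Complex.re h2
    rw [Complex.ofReal_re] at h3
    rw [← h3]
    exact (inner_self_eq_norm_sq (𝕜 := ℂ) _).symm
  rw [h1] at h
  refine h.trans (le_of_eq ?_)
  congr 1
  have hent : ∀ (i j : ℕ) (a b : Fin k × Fin 2), inner ℂ (basisSeq i a) (T (basisSeq j b)) =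
      fourierBlock A ((i : ℤ) - j) a b := fun i j a b => by
    rw [inner_basisSeq, basisSeq, hT]
  simp only [map_sum, map_smul, sum_inner, inner_sum, inner_smul_left, inner_smul_right, hent,
    RCLike.star_def]
  rw [Finset.sum_comm]
  refine Finset.sum_congr rfl fun p _ => ?_
  rw [Finset.mul_sum]
  exact Finset.sum_congr rfl fun q _ => by ring

end ToeplitzOperator

/-! ### The method of moments -/

section MomentMethod

variable {Ω : Type*} [MeasurableSpace Ω] {μ : Measure Ω} [IsProbabilityMeasure μ] {k : ℕ}
  {d : ∀ n : ℕ, Fin (n * k) → ℝ} {D : Ω → Fin k → ℝ} {K : ℝ}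

/-- Weierstrass approximation by even polynomials. -/
theorem exists_polynomial_sq_near (hK : 0 ≤ K) {f : ℝ → ℝ} (hf : ContinuousOn f (Icc 0 K)) {ε : ℝ}
    (hε : 0 < ε) :
    ∃ p : Polynomial ℝ, ∀ x ∈ Icc 0 K, |f x - p.eval (x ^ 2)| ≤ ε := by
  have h1 : ContinuousOn (fun y => f (Real.sqrt y)) (Icc 0 (K ^ 2)) := by
    refine hf.comp Real.continuous_sqrt.continuousOn fun y hy => ⟨Real.sqrt_nonneg _, ?_⟩
    exact Real.sqrt_le_iff.2 ⟨hK, hy.2⟩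
  obtain ⟨p, hp⟩ := exists_polynomial_near_of_continuousOn 0 (K ^ 2) _ h1 ε hε
  refine ⟨p, fun x hx => ?_⟩
  have h2 := hp (x ^ 2) ⟨by positivity, pow_le_pow_left₀ hx.1 hx.2 2⟩
  rw [Real.sqrt_sq hx.1, abs_sub_comm] at h2
  exact h2.le

theorem sum_eval_sq {ι : Type*} [Fintype ι] (p : Polynomial ℝ) (x : ι → ℝ) :
    ∑ j, p.eval (x j ^ 2) =
      ∑ q ∈ Finset.range (p.natDegree + 1), p.coeff q * ∑ j, (x j ^ 2) ^ q := by
  simp only [Polynomial.eval_eq_sum_range, Finset.mul_sum]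
  exact Finset.sum_comm

theorem abs_sum_sub_sum_le {ι : Type*} [Fintype ι] {f g : ℝ → ℝ} {ε : ℝ}
    (hfg : ∀ x ∈ Icc 0 K, |f x - g x| ≤ ε) {x : ι → ℝ} (hx : ∀ j, x j ∈ Icc 0 K) :
    |∑ j, f (x j) - ∑ j, g (x j)| ≤ Fintype.card ι * ε := by
  rw [← Finset.sum_sub_distrib]
  refine (Finset.abs_sum_le_sum_abs _ _).trans ?_
  refine (Finset.sum_le_sum fun j _ => hfg _ (hx j)).trans (le_of_eq ?_)
  simp

theorem integrable_sum_pow (hD : ∀ᵐ ω ∂μ, ∀ j, D ω j ∈ Icc 0 K)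
    (hmeas : ∀ q : ℕ, AEStronglyMeasurable (fun ω => ∑ j, (D ω j ^ 2) ^ q) μ) (q : ℕ) :
    Integrable (fun ω => ∑ j, (D ω j ^ 2) ^ q) μ := by
  refine Integrable.of_bound (hmeas q) (k * (K ^ 2) ^ q) ?_
  filter_upwards [hD] with ω hω
  rw [Real.norm_of_nonneg (Finset.sum_nonneg fun j _ => by positivity)]
  refine (Finset.sum_le_sum fun j _ => pow_le_pow_left₀ (by positivity)
    (pow_le_pow_left₀ (hω j).1 (hω j).2 2) q).trans (le_of_eq ?_)
  simp

theorem integrable_sum_eval_sq (hD : ∀ᵐ ω ∂μ, ∀ j, D ω j ∈ Icc 0 K)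
    (hmeas : ∀ q : ℕ, AEStronglyMeasurable (fun ω => ∑ j, (D ω j ^ 2) ^ q) μ)
    (p : Polynomial ℝ) : Integrable (fun ω => ∑ j, p.eval (D ω j ^ 2)) μ := by
  simp only [sum_eval_sq]
  exact integrable_finsetSum _ fun q _ => (integrable_sum_pow hD hmeas q).const_mul _

theorem integrable_sum_comp (hK : 0 ≤ K) (hD : ∀ᵐ ω ∂μ, ∀ j, D ω j ∈ Icc 0 K)
    (hmeas : ∀ q : ℕ, AEStronglyMeasurable (fun ω => ∑ j, (D ω j ^ 2) ^ q) μ) {f : ℝ → ℝ}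
    (hf : ContinuousOn f (Icc 0 K)) : Integrable (fun ω => ∑ j, f (D ω j)) μ := by
  choose p hp using fun m : ℕ => exists_polynomial_sq_near hK hf (Nat.one_div_pos_of_nat (n := m))
  have hm : AEStronglyMeasurable (fun ω => ∑ j, f (D ω j)) μ := by
    refine aestronglyMeasurable_of_tendsto_ae atTop
      (f := fun (m : ℕ) ω => ∑ j, (p m).eval (D ω j ^ 2))
      (fun m => (integrable_sum_eval_sq hD hmeas (p m)).1) ?_
    filter_upwards [hD] with ω hω
    rw [tendsto_iff_dist_tendsto_zero]
    have h1 := (tendsto_one_div_add_atTop_nhds_zero_nat (𝕜 := ℝ)).const_mul (k : ℝ)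
    rw [mul_zero] at h1
    refine squeeze_zero (fun _ => dist_nonneg) (fun m => ?_) h1
    have h2 := abs_sum_sub_sum_le (g := fun x => (p m).eval (x ^ 2)) (hp m) hω
    rw [dist_comm, Real.dist_eq]
    simpa using h2
  refine Integrable.mono' ((integrable_sum_eval_sq hD hmeas (p 0)).norm.add
    (integrable_const (k : ℝ))) hm ?_
  filter_upwards [hD] with ω hω
  have h2 := abs_sum_sub_sum_le (g := fun x => (p 0).eval (x ^ 2)) (hp 0) hω
  simp only [Fintype.card_fin, Nat.cast_zero, zero_add, div_one, mul_one] at h2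
  rw [← Real.norm_eq_abs] at h2
  have h3 := norm_sub_norm_le (∑ j, f (D ω j)) (∑ j, (p 0).eval (D ω j ^ 2))
  simp only [Pi.add_apply]
  linarith

/-- The method of moments on a compact interval: convergence of the normalized even power sums
implies convergence of the normalized sums of every continuous function. -/
theorem tendsto_sum_comp_of_moments (hK : 0 ≤ K) (hd : ∀ n j, d n j ∈ Icc 0 K)
    (hD : ∀ᵐ ω ∂μ, ∀ j, D ω j ∈ Icc 0 K)
    (hmeas : ∀ q : ℕ, AEStronglyMeasurable (fun ω => ∑ j, (D ω j ^ 2) ^ q) μ)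
    (hmom : ∀ q : ℕ, Tendsto (fun n : ℕ => (n : ℝ)⁻¹ * ∑ j, (d n j ^ 2) ^ q) atTop
      (𝓝 (∫ ω, ∑ j, (D ω j ^ 2) ^ q ∂μ))) {f : ℝ → ℝ} (hf : ContinuousOn f (Icc 0 K)) :
    Tendsto (fun n : ℕ => (n : ℝ)⁻¹ * ∑ j, f (d n j)) atTop
      (𝓝 (∫ ω, ∑ j, f (D ω j) ∂μ)) := by
  have hpoly : ∀ p : Polynomial ℝ, Tendsto (fun n : ℕ => (n : ℝ)⁻¹ * ∑ j, p.eval (d n j ^ 2)) atTop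
      (𝓝 (∫ ω, ∑ j, p.eval (D ω j ^ 2) ∂μ)) := by
    intro p
    simp only [sum_eval_sq]
    rw [integral_finsetSum _ fun q _ => (integrable_sum_pow hD hmeas q).const_mul _]
    simp only [integral_const_mul]
    have h := tendsto_finsetSum (Finset.range (p.natDegree + 1))
      fun q _ => (hmom q).const_mul (p.coeff q)
    refine h.congr fun n => ?_
    rw [Finset.mul_sum]
    exact Finset.sum_congr rfl fun q _ => mul_left_comm _ _ _
  rw [Metric.tendsto_atTop]
  intro ε hε
  set δ : ℝ := ε / (3 * (k + 1)) with hδ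
  have hδ0 : 0 < δ := by positivity
  have hkδ : k * δ ≤ ε / 3 := by
    rw [hδ, ← mul_div_assoc, div_le_div_iff₀ (by positivity) (by norm_num)]
    nlinarith
  obtain ⟨p, hp⟩ := exists_polynomial_sq_near hK hf hδ0
  obtain ⟨N, hN⟩ := Metric.tendsto_atTop.1 (hpoly p) (ε / 3) (by positivity)
  refine ⟨N, fun n hn => ?_⟩
  have h1 : dist ((n : ℝ)⁻¹ * ∑ j, f (d n j)) ((n : ℝ)⁻¹ * ∑ j, p.eval (d n j ^ 2)) ≤ ε / 3 := by
    rw [Real.dist_eq, ← mul_sub, abs_mul, abs_of_nonneg (by positivity : (0 : ℝ) ≤ (n : ℝ)⁻¹)]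
    have h2 := abs_sum_sub_sum_le (g := fun x => p.eval (x ^ 2)) hp (hd n)
    rw [Fintype.card_fin, Nat.cast_mul] at h2
    rcases Nat.eq_zero_or_pos n with rfl | hn0
    · simp only [Nat.cast_zero, inv_zero, zero_mul]; positivity
    · calc _ ≤ (n : ℝ)⁻¹ * (n * k * δ) := by gcongr
        _ = k * δ := by field_simp
        _ ≤ _ := hkδ
  have h3 : dist (∫ ω, ∑ j, p.eval (D ω j ^ 2) ∂μ) (∫ ω, ∑ j, f (D ω j) ∂μ) ≤ ε / 3 := by
    rw [dist_comm, Real.dist_eq, ← integral_sub (integrable_sum_comp hK hD hmeas hf)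
      (integrable_sum_eval_sq hD hmeas p)]
    have h4 : ∀ᵐ ω ∂μ, ‖∑ j, f (D ω j) - ∑ j, p.eval (D ω j ^ 2)‖ ≤ k * δ := by
      filter_upwards [hD] with ω hω
      simpa using abs_sum_sub_sum_le (g := fun x => p.eval (x ^ 2)) hp hω
    have h5 := norm_integral_le_of_norm_le_const h4
    simp only [probReal_univ, mul_one] at h5
    exact h5.trans hkδ
  have h6 := hN n hn
  have h7 := dist_triangle4 ((n : ℝ)⁻¹ * ∑ j, f (d n j)) ((n : ℝ)⁻¹ * ∑ j, p.eval (d n j ^ 2))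
    (∫ ω, ∑ j, p.eval (D ω j ^ 2) ∂μ) (∫ ω, ∑ j, f (D ω j) ∂μ)
  linarith

/-- The method of moments for real- or complex-valued continuous functions. -/
theorem integrable_and_tendsto_of_moments {𝕜 : Type*} [RCLike 𝕜] (hK : 0 ≤ K)
    (hd : ∀ n j, d n j ∈ Icc 0 K) (hD : ∀ᵐ ω ∂μ, ∀ j, D ω j ∈ Icc 0 K)
    (hmeas : ∀ q : ℕ, AEStronglyMeasurable (fun ω => ∑ j, (D ω j ^ 2) ^ q) μ)
    (hmom : ∀ q : ℕ, Tendsto (fun n : ℕ => (n : ℝ)⁻¹ * ∑ j, (d n j ^ 2) ^ q) atTop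
      (𝓝 (∫ ω, ∑ j, (D ω j ^ 2) ^ q ∂μ))) {f : ℝ → 𝕜} (hf : ContinuousOn f (Icc 0 K)) :
    Integrable (fun ω => ∑ j, f (D ω j)) μ ∧
    Tendsto (fun n : ℕ => (n : ℝ)⁻¹ • ∑ j, f (d n j)) atTop (𝓝 (∫ ω, ∑ j, f (D ω j) ∂μ)) := by
  have hre : ContinuousOn (fun x => RCLike.re (f x)) (Icc 0 K) :=
    RCLike.continuous_re.comp_continuousOn hf
  have him : ContinuousOn (fun x => RCLike.im (f x)) (Icc 0 K) :=
    RCLike.continuous_im.comp_continuousOn hf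
  have hsplit : ∀ {ι : Type} [Fintype ι] (x : ι → ℝ), ∑ j, f (x j) =
      ((∑ j, RCLike.re (f (x j)) : ℝ) : 𝕜) + ((∑ j, RCLike.im (f (x j)) : ℝ) : 𝕜) * RCLike.I := by
    intro ι _ x
    rw [RCLike.ofReal_sum, RCLike.ofReal_sum, Finset.sum_mul, ← Finset.sum_add_distrib]
    exact Finset.sum_congr rfl fun j _ => (RCLike.re_add_im _).symm
  have hire := integrable_sum_comp hK hD hmeas hre
  have hiim := integrable_sum_comp hK hD hmeas him
  simp only [hsplit]
  refine ⟨hire.ofReal.add (hiim.ofReal.mul_const _), ?_⟩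
  rw [integral_add hire.ofReal (hiim.ofReal.mul_const _), integral_mul_const, integral_ofReal,
    integral_ofReal]
  have h1 := (RCLike.continuous_ofReal (K := 𝕜)).tendsto _ |>.comp
    (tendsto_sum_comp_of_moments hK hd hD hmeas hmom hre)
  have h2 := (RCLike.continuous_ofReal (K := 𝕜)).tendsto _ |>.comp
    (tendsto_sum_comp_of_moments hK hd hD hmeas hmom him)
  refine (h1.add (h2.mul_const RCLike.I)).congr fun n => ?_
  simp only [Function.comp, RCLike.ofReal_mul, smul_add, RCLike.real_smul_eq_coe_mul, mul_assoc]

end MomentMethod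

/-! ### Transport between the circle and the interval -/

section Transport

open AddCircle Matrix
open scoped Matrix.Norms.L2Operator

instance fact_two_pi_pos : Fact (0 < 2 * π) := ⟨Real.two_pi_pos⟩

/-- The representative in `(-π, π]` of a point of the circle. -/
noncomputable def circleRep (t : AddCircle (2 * π)) : ℝ := equivIoc (2 * π) (-π) t

theorem neg_pi_add_two_pi : -π + 2 * π = π := by ring

theorem circleRep_coe {θ : ℝ} (hθ : θ ∈ Ioc (-π) π) : circleRep (θ : AddCircle (2 * π)) = θ := by
  rw [circleRep, equivIoc_coe_of_mem]
  rwa [neg_pi_add_two_pi]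

theorem measurePreserving_coe : MeasurePreserving ((↑) : ℝ → AddCircle (2 * π))
    (volume.restrict (Ioc (-π) π)) volume := by
  have h := AddCircle.measurePreserving_mk (2 * π) (-π)
  rwa [neg_pi_add_two_pi] at h

theorem ae_circleRep_coe : ∀ᵐ θ : ℝ ∂(volume.restrict (Ioc (-π) π)),
    circleRep (θ : AddCircle (2 * π)) = θ := by
  filter_upwards [ae_restrict_mem measurableSet_Ioc] with θ hθ using circleRep_coe hθ

theorem measurePreserving_circleRep :
    MeasurePreserving circleRep volume (volume.restrict (Ioc (-π) π)) := by
  have hm : Measurable circleRep :=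
    measurable_subtype_coe.comp (measurableEquivIoc (2 * π) (-π)).measurable
  refine ⟨hm, ?_⟩
  rw [← measurePreserving_coe.map_eq, Measure.map_map hm measurePreserving_coe.measurable]
  exact (Measure.map_congr (g := id) ae_circleRep_coe).trans Measure.map_id

theorem ae_haarAddCircle_iff {P : AddCircle (2 * π) → Prop} :
    (∀ᵐ t ∂haarAddCircle, P t) ↔ ∀ᵐ t, P t := by
  rw [volume_eq_smul_haarAddCircle, Measure.ae_ennreal_smul_measure_iff]
  simpa using Real.pi_pos

/-- Almost everywhere on the interval is the same as almost everywhere on the circle. -/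
theorem ae_Icc_iff_ae_circle {P : ℝ → Prop} :
    (∀ᵐ θ ∂(volume.restrict (Icc (-π) π)), P θ) ↔ ∀ᵐ t ∂haarAddCircle, P (circleRep t) := by
  rw [← restrict_Ioc_eq_restrict_Icc, ae_haarAddCircle_iff]
  constructor
  · exact fun h => measurePreserving_circleRep.quasiMeasurePreserving.ae h
  · intro h
    filter_upwards [measurePreserving_coe.quasiMeasurePreserving.ae h, ae_circleRep_coe]
      with θ h1 h2
    rwa [h2] at h1

theorem intervalIntegral_eq_integral_circle {E : Type*} [NormedAddCommGroup E] [NormedSpace ℝ E]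
    (g : ℝ → E) : ∫ θ in (-π)..π, g θ = (2 * π) • ∫ t, g (circleRep t) ∂haarAddCircle := by
  rw [integral_haarAddCircle, smul_inv_smul₀ Real.two_pi_pos.ne',
    ← AddCircle.intervalIntegral_preimage (2 * π) (-π), neg_pi_add_two_pi]
  rw [intervalIntegral.integral_of_le (by linarith [Real.pi_pos]),
    intervalIntegral.integral_of_le (by linarith [Real.pi_pos])]
  refine integral_congr_ae ?_
  filter_upwards [ae_circleRep_coe] with θ hθ
  rw [hθ]

theorem intervalIntegrable_of_integrable_circle {E : Type*} [NormedAddCommGroup E] {g : ℝ → E}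
    (hg : Integrable (fun t => g (circleRep t)) haarAddCircle) :
    IntervalIntegrable g volume (-π) π := by
  rw [intervalIntegrable_iff_integrableOn_Ioc_of_le (by linarith [Real.pi_pos])]
  have h1 : Integrable (fun t => g (circleRep t)) volume := by
    rw [volume_eq_smul_haarAddCircle]
    exact hg.smul_measure ENNReal.ofReal_ne_top
  have h2 := measurePreserving_coe.integrable_comp_of_integrable h1
  refine h2.congr ?_
  filter_upwards [ae_circleRep_coe] with θ hθ
  simp only [Function.comp, hθ]

theorem memLp_comp_circleRep {f : ℝ → ℂ} (hf : MemLp f ∞ (volume.restrict (Icc (-π) π))) :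
    MemLp (fun t => f (circleRep t)) ∞ haarAddCircle := by
  rw [memLp_haarAddCircle_iff]
  rw [← restrict_Ioc_eq_restrict_Icc] at hf
  exact hf.comp_measurePreserving measurePreserving_circleRep

variable {k : ℕ} {A : ℝ → CMat k}

theorem fourierBlock_apply_eq_fourierCoeff (A : ℝ → CMat k) (n : ℤ) (a b : Fin k × Fin 2) :
    fourierBlock A n a b = fourierCoeff (fun t => A (circleRep t) a b) n := by
  have h := intervalIntegral_eq_integral_circle fun θ =>
    A θ a b * Complex.exp (-Complex.I * n * θ)
  rw [fourierBlock, of_apply, h, Complex.real_smul, ← mul_assoc]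
  have hπ : (2 * (π : ℂ))⁻¹ * ((2 * π : ℝ) : ℂ) = 1 := by
    push_cast
    exact inv_mul_cancel₀ (by exact_mod_cast Real.two_pi_pos.ne')
  rw [hπ, one_mul, fourierCoeff]
  refine integral_congr_ae (Eventually.of_forall fun t => ?_)
  have h1 : ((circleRep t : ℝ) : AddCircle (2 * π)) = t := coe_equivIoc
  simp only [smul_eq_mul]
  conv_rhs => rw [← h1, fourier_coe_apply]
  rw [h1, mul_comm]
  congr 2
  have : (π : ℂ) ≠ 0 := by exact_mod_cast Real.pi_pos.ne'
  push_cast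
  field_simp

theorem isBoundedSymbol_circle (hA : IsLInftySymbol A) :
    IsBoundedSymbol fun t => A (circleRep t) := by
  intro a b
  exact memLp_comp_circleRep (f := fun θ => A θ a b) (hA.2 a b)

/-- The norm of a symbol bounds the operator norm of its values almost everywhere. -/
theorem ae_norm_le_symbolNorm (hA : IsLInftySymbol A) :
    ∀ᵐ θ ∂(volume.restrict (Icc (-π) π)), ‖A θ‖ ≤ symbolNorm A := by
  obtain ⟨K, -, hK⟩ := (isBoundedSymbol_circle hA).exists_ae_norm_le
  have hK' : ∀ᵐ θ ∂(volume.restrict (Icc (-π) π)), ‖A θ‖ ≤ K :=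
    (ae_Icc_iff_ae_circle (P := fun θ => ‖A θ‖ ≤ K)).2 hK
  have hdef : symbolNorm A = essSup (fun θ => ‖A θ‖) (volume.restrict (Icc (-π) π)) := by
    simp only [symbolNorm, l2_opNorm_toEuclideanCLM]
  rw [hdef]
  exact ae_le_essSup (f := fun θ => ‖A θ‖) (isBoundedUnder_of_eventually_le hK')

theorem ae_circle_norm_le_symbolNorm (hA : IsLInftySymbol A) :
    ∀ᵐ t ∂haarAddCircle, ‖A (circleRep t)‖ ≤ symbolNorm A :=
  (ae_Icc_iff_ae_circle (P := fun θ => ‖A θ‖ ≤ symbolNorm A)).1 (ae_norm_le_symbolNorm hA)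

theorem symbolNorm_nonneg (hA : IsLInftySymbol A) : 0 ≤ symbolNorm A := by
  obtain ⟨t, ht⟩ := (ae_circle_norm_le_symbolNorm hA).exists
  exact (norm_nonneg _).trans ht

end Transport

section Symbol

open AddCircle Matrix
open scoped ComplexOrder

variable {k : ℕ} {A : ℝ → CMat k} {T : L2Seq k →L[ℂ] L2Seq k}

/-! ### Existence of the symplectic eigenvalues -/

section Positivity

/-- A self-adjoint block Toeplitz operator satisfies `A_n = (A_{-n})ᴴ`. -/
theorem fourierBlock_eq_star (hT : IsGeneratedBy T A) (hpos : IsPositiveInvertible T) (n : ℤ)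
    (a b : Fin k × Fin 2) : fourierBlock A n a b = star (fourierBlock A (-n) b a) := by
  have hent : ∀ (i j : ℕ) (a b : Fin k × Fin 2), inner ℂ (basisSeq i a) (T (basisSeq j b)) =
      fourierBlock A ((i : ℤ) - j) a b := fun i j a b => by
    rw [inner_basisSeq, basisSeq, hT]
  have hij : ∀ i j : ℕ, fourierBlock A ((i : ℤ) - j) a b =
      star (fourierBlock A (-((i : ℤ) - j)) b a) := by
    intro i j
    have h1 := hpos.1.isSymmetric (basisSeq i a) (basisSeq j b)
    rw [neg_sub, ← hent i j, ← hent j i]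
    exact h1.symm.trans (inner_conj_symm _ _).symm
  rcases Int.eq_nat_or_neg n with ⟨m, rfl | rfl⟩
  · simpa using hij m 0
  · simpa using hij 0 m

/-- A complex matrix that is Hermitian, and whose quadratic form has a real part bounded below by a
positive multiple of the squared norm, is positive definite. -/
theorem posDef_of_re_ge {κ : Type*} [Fintype κ] {B : Matrix κ κ ℂ} (hB : B.IsHermitian) {c : ℝ}
    (hc : 0 < c) (h : ∀ x : κ → ℂ, c * ∑ p, ‖x p‖ ^ 2 ≤ (star x ⬝ᵥ (B *ᵥ x)).re) : B.PosDef := by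
  refine PosDef.of_dotProduct_mulVec_pos hB fun x hx => ?_
  rw [Complex.lt_def]
  refine ⟨lt_of_lt_of_le (mul_pos hc ?_) (h x), (hB.im_star_dotProduct_mulVec_self x).symm⟩
  obtain ⟨p, hp⟩ := Function.ne_iff.1 hx
  exact Finset.sum_pos' (fun _ _ => by positivity) ⟨p, Finset.mem_univ _, by
    have := norm_pos_iff.2 hp
    positivity⟩

theorem star_dotProduct_mulVec_eq_sum {κ : Type*} [Fintype κ] (B : Matrix κ κ ℂ) (x : κ → ℂ) :
    star x ⬝ᵥ (B *ᵥ x) = ∑ p, ∑ q, star (x p) * x q * B p q := by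
  simp only [dotProduct, mulVec, Finset.mul_sum, Pi.star_apply]
  exact Finset.sum_congr rfl fun p _ => Finset.sum_congr rfl fun q _ => by ring

/-- The numbering of the rows of the truncated matrix by the block and the index in the block. -/
def blockEquiv (n k : ℕ) : Fin (n * k) × Fin 2 ≃ Fin n × (Fin k × Fin 2) :=
  (finProdFinEquiv.symm.prodCongr (Equiv.refl _)).trans (Equiv.prodAssoc _ _ _)

theorem truncation_apply (A : ℝ → CMat k) (n : ℕ) (p q : Fin (n * k) × Fin 2) :
    truncation A n p q = fourierBlock A (((blockEquiv n k p).1 : ℤ) - ((blockEquiv n k q).1 : ℤ))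
      (blockEquiv n k p).2 (blockEquiv n k q).2 := rfl

theorem exists_isSymplecticSpectrum_truncation (hT : IsGeneratedBy T A)
    (hsymm : IsPartiallySymmetric A) (hpos : IsPositiveInvertible T) (n : ℕ) :
    ∃ d, IsSymplecticSpectrum (truncation A n) d := by
  obtain ⟨c, hc0, hc⟩ := exists_pos_mul_sq_norm_le hpos
  refine exists_isSymplecticSpectrum (fun a b => hsymm.1 _ _ _) (posDef_of_re_ge ?_ hc0 fun x => ?_)
  · ext p q
    rw [conjTranspose_apply, truncation_apply, truncation_apply,
      fourierBlock_eq_star hT hpos _ (blockEquiv n k p).2, neg_sub]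
  · rw [star_dotProduct_mulVec_eq_sum]
    refine re_form_ge_of_isGeneratedBy hT hc Finset.univ (fun p => ((blockEquiv n k p).1 : ℕ))
      (fun p => (blockEquiv n k p).2) (fun p _ q _ h => ?_) x
    exact (blockEquiv n k).injective (Prod.ext (Fin.ext h.1) h.2)

theorem ae_im_eq_zero (hA : IsLInftySymbol A) (hsymm : IsPartiallySymmetric A) :
    ∀ᵐ t ∂haarAddCircle, ∀ a b, (A (circleRep t) a b).im = 0 := by
  rw [ae_all_iff]; intro a
  rw [ae_all_iff]; intro b
  have hm := isBoundedSymbol_circle hA a b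
  have h := ae_eq_of_fourierCoeff_eq hm.star hm fun n => by
    have h1 := fourierCoeff_star (fun t => A (circleRep t) a b) n
    rw [← fourierBlock_apply_eq_fourierCoeff, hsymm.2] at h1
    refine h1.trans ?_
    rw [← fourierBlock_apply_eq_fourierCoeff]
    exact Complex.conj_eq_iff_im.2 (hsymm.1 n a b)
  filter_upwards [h] with t ht
  exact Complex.conj_eq_iff_im.1 ht

theorem ae_symm (hA : IsLInftySymbol A) (hT : IsGeneratedBy T A) (hsymm : IsPartiallySymmetric A)
    (hpos : IsPositiveInvertible T) :
    ∀ᵐ t ∂haarAddCircle, ∀ a b, A (circleRep t) a b = A (circleRep t) b a := by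
  rw [ae_all_iff]; intro a
  rw [ae_all_iff]; intro b
  refine ae_eq_of_fourierCoeff_eq (isBoundedSymbol_circle hA a b) (isBoundedSymbol_circle hA b a)
    fun n => ?_
  rw [← fourierBlock_apply_eq_fourierCoeff, ← fourierBlock_apply_eq_fourierCoeff,
    fourierBlock_eq_star hT hpos, hsymm.2]
  exact Complex.conj_eq_iff_im.2 (hsymm.1 n b a)

/-- A lower bound of the Toeplitz operator is a lower bound of its symbol in the direction of a
fixed vector. -/
theorem ae_form_ge (hA : IsLInftySymbol A) (hT : IsGeneratedBy T A) {c : ℝ}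
    (hc : ∀ x, c * ‖x‖ ^ 2 ≤ (inner ℂ x (T x)).re) (v : Fin k × Fin 2 → ℂ) :
    ∀ᵐ t ∂haarAddCircle, c * ∑ a, ‖v a‖ ^ 2 ≤ (star v ⬝ᵥ (A (circleRep t) *ᵥ v)).re := by
  have hb := isBoundedSymbol_circle hA
  have hmem : ∀ a b, MemLp (fun t => star (v a) * v b * A (circleRep t) a b) ∞ haarAddCircle :=
    fun a b => (hb a b).const_mul _
  have hfun : (fun t => star v ⬝ᵥ (A (circleRep t) *ᵥ v)) =
      ∑ a, ∑ b, fun t => star (v a) * v b * A (circleRep t) a b := by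
    ext t
    simp only [star_dotProduct_mulVec_eq_sum, Finset.sum_apply]
  have hφ : MemLp (fun t => star v ⬝ᵥ (A (circleRep t) *ᵥ v)) ∞ haarAddCircle := by
    rw [hfun]
    exact memLp_finsetSum' _ fun a _ => memLp_finsetSum' _ fun b _ => hmem a b
  have hcoeff : ∀ n, fourierCoeff (fun t => star v ⬝ᵥ (A (circleRep t) *ᵥ v)) n =
      ∑ a, ∑ b, star (v a) * v b * fourierBlock A n a b := by
    intro n
    rw [hfun, fourierCoeff.sum _ _ fun a _ => integrable_finsetSum' _ fun b _ =>
      integrable_of_memLp_top (hmem a b), Finset.sum_apply]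
    refine Finset.sum_congr rfl fun a _ => ?_
    rw [fourierCoeff.sum _ _ fun b _ => integrable_of_memLp_top (hmem a b), Finset.sum_apply]
    refine Finset.sum_congr rfl fun b _ => ?_
    rw [fourierCoeff.const_mul, fourierBlock_apply_eq_fourierCoeff]
  refine ae_le_re_of_toeplitz_form_ge hφ fun s w => ?_
  -- Frequencies are shifted to be nonnegative; Toeplitz forms depend on differences only.
  set N : ℤ := ∑ i ∈ s, |i| with hN
  have hNs : ∀ i ∈ s, 0 ≤ i + N := fun i hi => by
    have h1 : |i| ≤ N := Finset.single_le_sum (f := fun i : ℤ => |i|)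
      (fun _ _ => abs_nonneg _) hi
    have h2 := neg_abs_le i
    linarith
  have h := re_form_ge_of_isGeneratedBy hT hc (s ×ˢ (Finset.univ : Finset (Fin k × Fin 2)))
    (fun p => (p.1 + N).toNat) (fun p => p.2) (by
      rintro ⟨i, a⟩ hp ⟨j, b⟩ hq ⟨h1, h2⟩
      have hi := hNs i (Finset.mem_product.1 hp).1
      have hj := hNs j (Finset.mem_product.1 hq).1
      simp only at h1 h2
      refine Prod.ext ?_ h2
      simp only
      omega) (fun p => w p.1 * v p.2)
  have hl : ∑ p ∈ s ×ˢ (Finset.univ : Finset (Fin k × Fin 2)), ‖w p.1 * v p.2‖ ^ 2 =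
      (∑ a, ‖v a‖ ^ 2) * ∑ i ∈ s, ‖w i‖ ^ 2 := by
    simp only [norm_mul, mul_pow]
    rw [mul_comm, Finset.sum_mul_sum, Finset.sum_product]
  rw [hl, ← mul_assoc] at h
  refine h.trans (le_of_eq ?_)
  congr 1
  rw [Finset.sum_product]
  refine Finset.sum_congr rfl fun i hi => ?_
  simp only [Finset.sum_product]
  rw [Finset.sum_comm]
  refine Finset.sum_congr rfl fun j hj => ?_
  have hij : (((i + N).toNat : ℕ) : ℤ) - (((j + N).toNat : ℕ) : ℤ) = i - j := by
    have := hNs i hi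
    have := hNs j hj
    omega
  rw [hcoeff, Finset.mul_sum]
  refine Finset.sum_congr rfl fun a _ => ?_
  rw [Finset.mul_sum]
  refine Finset.sum_congr rfl fun b _ => ?_
  rw [hij, star_mul']
  ring

theorem ae_exists_isSymplecticSpectrum (hA : IsLInftySymbol A) (hT : IsGeneratedBy T A)
    (hsymm : IsPartiallySymmetric A) (hpos : IsPositiveInvertible T) :
    ∀ᵐ t ∂haarAddCircle, ∃ d, IsSymplecticSpectrum (A (circleRep t)) d := by
  obtain ⟨c, hc0, hc⟩ := exists_pos_mul_sq_norm_le hpos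
  have hdense : ∀ᵐ t ∂haarAddCircle, ∀ m : ℕ,
      c * ∑ a, ‖TopologicalSpace.denseSeq (Fin k × Fin 2 → ℂ) m a‖ ^ 2 ≤
        (star (TopologicalSpace.denseSeq (Fin k × Fin 2 → ℂ) m) ⬝ᵥ
          (A (circleRep t) *ᵥ TopologicalSpace.denseSeq (Fin k × Fin 2 → ℂ) m)).re :=
    ae_all_iff.2 fun m => ae_form_ge hA hT hc _
  filter_upwards [hdense, ae_im_eq_zero hA hsymm, ae_symm hA hT hsymm hpos] with t h1 h2 h3
  refine exists_isSymplecticSpectrum h2 (posDef_of_re_ge ?_ hc0 fun x => ?_)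
  · ext a b
    rw [conjTranspose_apply, h3 a b]
    exact Complex.conj_eq_iff_im.2 (h2 b a)
  · have hclosed : IsClosed {x : Fin k × Fin 2 → ℂ |
        c * ∑ a, ‖x a‖ ^ 2 ≤ (star x ⬝ᵥ (A (circleRep t) *ᵥ x)).re} := by
      refine isClosed_le (by fun_prop) ?_
      simp only [star_dotProduct_mulVec_eq_sum]
      fun_prop
    exact (TopologicalSpace.denseRange_denseSeq _).induction_on x hclosed h1

end Positivity

/-! ### Multiplication by `J` on truncations, and even power sums -/

section Moments

open scoped Matrix.Norms.L2Operator

theorem complexJ_mul_apply {m : ℕ} (X : CMat m) (p q : Fin m × Fin 2) :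
    (complexJ m * X) p q =
      ∑ s, ((!![0, 1; -1, 0] : Matrix (Fin 2) (Fin 2) ℝ) p.2 s : ℂ) * X (p.1, s) q := by
  rw [Matrix.mul_apply, Fintype.sum_prod_type, Finset.sum_eq_single p.1]
  · simp only [complexJ_apply, if_true]
  · intro i _ hi
    simp only [complexJ_apply, if_neg hi.symm, zero_mul, Finset.sum_const_zero]
  · simp

theorem isBoundedSymbol_complexJ_mul (hA : IsLInftySymbol A) :
    IsBoundedSymbol fun t => complexJ k * A (circleRep t) :=
  (isBoundedSymbol_const (complexJ k)).mul (isBoundedSymbol_circle hA)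

theorem truncation_eq_submatrix (A : ℝ → CMat k) (n : ℕ) :
    truncation A n =
      (blockToeplitz (fun t => A (circleRep t)) n).submatrix (blockEquiv n k) (blockEquiv n k) := by
  ext p q
  rw [truncation_apply, fourierBlock_apply_eq_fourierCoeff]
  rfl

/-- Multiplication by `J` commutes with the formation of block Toeplitz matrices, since `J` is block
diagonal with constant blocks. -/
theorem complexJ_mul_truncation (hA : IsLInftySymbol A) (n : ℕ) :
    complexJ (n * k) * truncation A n =
      (blockToeplitz (fun t => complexJ k * A (circleRep t)) n).submatrix
        (blockEquiv n k) (blockEquiv n k) := by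
  ext p q
  have hR : ((blockToeplitz (fun t => complexJ k * A (circleRep t)) n).submatrix
      (blockEquiv n k) (blockEquiv n k)) p q =
      fourierCoeff (fun t => (complexJ k * A (circleRep t)) (blockEquiv n k p).2
        (blockEquiv n k q).2) (((blockEquiv n k p).1 : ℤ) - ((blockEquiv n k q).1 : ℤ)) := rfl
  have hsum : (fun t => (complexJ k * A (circleRep t)) (blockEquiv n k p).2
      (blockEquiv n k q).2) = ∑ s, fun t =>
        ((!![0, 1; -1, 0] : Matrix (Fin 2) (Fin 2) ℝ) p.2 s : ℂ) *
          A (circleRep t) ((blockEquiv n k p).2.1, s) (blockEquiv n k q).2 := by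
    ext t
    rw [complexJ_mul_apply, Finset.sum_apply]
    rfl
  rw [complexJ_mul_apply, hR, hsum, fourierCoeff.sum _ _ fun s _ =>
    (integrable_of_memLp_top (isBoundedSymbol_circle hA _ _)).const_mul _, Finset.sum_apply]
  refine Finset.sum_congr rfl fun s _ => ?_
  rw [fourierCoeff.const_mul, truncation_apply, fourierBlock_apply_eq_fourierCoeff]
  rfl

theorem trace_neg_mul_self_pow {κ : Type*} [Fintype κ] [DecidableEq κ] (X : Matrix κ κ ℂ) (q : ℕ) :
    trace ((-(X * X)) ^ q) = (-1) ^ q * trace (X ^ (2 * q)) := by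
  have h : -(X * X) = (-1 : ℂ) • X ^ 2 := by rw [sq, neg_one_smul]
  rw [h, smul_pow, trace_smul, pow_mul, smul_eq_mul]

theorem trace_submatrix_pow {κ κ' : Type*} [Fintype κ] [DecidableEq κ] [Fintype κ']
    [DecidableEq κ'] (X : Matrix κ κ ℂ) (e : κ' ≃ κ) (q : ℕ) :
    trace ((X.submatrix e e) ^ q) = trace (X ^ q) := by
  have h : (X.submatrix e e) ^ q = (X ^ q).submatrix e e :=
    (map_pow (reindexAlgEquiv ℂ ℂ e.symm) X q).symm
  rw [h, trace, trace]
  exact e.sum_comp fun i => (X ^ q) i i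

/-- The even power sums of the symplectic eigenvalues, as traces. -/
theorem IsSymplecticSpectrum.sum_pow_eq {m : ℕ} {B : CMat m} {d : Fin m → ℝ}
    (h : IsSymplecticSpectrum B d) (q : ℕ) :
    ∑ j, (d j ^ 2) ^ q = (2⁻¹ * ((-1) ^ q * trace ((complexJ m * B) ^ (2 * q)))).re := by
  rw [← trace_neg_mul_self_pow]
  change _ = (2⁻¹ * trace (negSqJMul B ^ q)).re
  rw [h.trace_negSqJMul_pow, inv_mul_cancel_left₀ two_ne_zero, Complex.ofReal_re]

theorem norm_submatrix_le {κ κ' : Type*} [Fintype κ] [DecidableEq κ] [Fintype κ']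
    [DecidableEq κ'] (X : Matrix κ κ ℂ) (e : κ' ≃ κ) : ‖X.submatrix e e‖ ≤ ‖X‖ := by
  rw [← l2_opNorm_toEuclideanCLM]
  refine ContinuousLinearMap.opNorm_le_bound _ (norm_nonneg _) fun x => ?_
  have h1 : ‖(WithLp.toLp 2 (X *ᵥ (x.ofLp ∘ e.symm)) : EuclideanSpace ℂ κ)‖ ≤
      ‖X‖ * ‖(WithLp.toLp 2 (x.ofLp ∘ e.symm) : EuclideanSpace ℂ κ)‖ :=
    l2_opNorm_mulVec X (WithLp.toLp 2 (x.ofLp ∘ e.symm))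
  have h2 : ∀ v : κ → ℂ, ‖(WithLp.toLp 2 (v ∘ e) : EuclideanSpace ℂ κ')‖ =
      ‖(WithLp.toLp 2 v : EuclideanSpace ℂ κ)‖ := fun v => by
    rw [← sq_eq_sq₀ (norm_nonneg _) (norm_nonneg _), sq_norm_toLp, sq_norm_toLp]
    exact e.sum_comp fun p => ‖v p‖ ^ 2
  have h3 : toEuclideanCLM (n := κ') (𝕜 := ℂ) (X.submatrix e e) x =
      WithLp.toLp 2 ((X *ᵥ (x.ofLp ∘ e.symm)) ∘ e) := by
    rw [← submatrix_mulVec_equiv]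
    rfl
  have h4 : x = WithLp.toLp 2 ((x.ofLp ∘ e.symm) ∘ e) := by
    ext p
    simp
  rw [h3, h2]
  conv_rhs => rw [h4, h2]
  exact h1

theorem norm_truncation_le (hA : IsLInftySymbol A) (n : ℕ) :
    ‖truncation A n‖ ≤ symbolNorm A := by
  have h := norm_blockToeplitz_le (isBoundedSymbol_circle hA) (symbolNorm_nonneg hA)
    (ae_circle_norm_le_symbolNorm hA) n
  rw [truncation_eq_submatrix]
  exact (norm_submatrix_le _ _).trans h

end Moments

end Symbol

end SymplecticSzego

/-! ### The limit theorem -/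

theorem theorem4p1 {𝕜 : Type*} [RCLike 𝕜] (k : ℕ) (A : ℝ → CMat k) (T : L2Seq k →L[ℂ] L2Seq k)
    (hA : IsLInftySymbol A) (hT : IsGeneratedBy T A)
    (hsymm : IsPartiallySymmetric A) (hpos : IsPositiveInvertible T) :
    (∀ n : ℕ, IsSymplecticSpectrum (truncation A n) (symplecticEigenvalues (truncation A n))) ∧
    (∀ᵐ θ ∂(volume.restrict (Icc (-π) π)),
      IsSymplecticSpectrum (A θ) (symplecticEigenvalues (A θ))) ∧
    ∀ f : ℝ → 𝕜, ContinuousOn f (Icc 0 (symbolNorm A)) →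
      IntervalIntegrable (fun θ => ∑ j : Fin k, f (symplecticEigenvalues (A θ) j))
        volume (-π) π ∧
      Tendsto
        (fun n : ℕ => (1 / (n : ℝ)) •
          ∑ j : Fin (n * k), f (symplecticEigenvalues (truncation A n) j))
        atTop
        (𝓝 ((1 / (2 * π)) •
          ∫ θ in (-π)..π, ∑ j : Fin k, f (symplecticEigenvalues (A θ) j))) := by
  have hn : ∀ n : ℕ,
      IsSymplecticSpectrum (truncation A n) (symplecticEigenvalues (truncation A n)) :=
    fun n => isSymplecticSpectrum_symplecticEigenvalues
      (exists_isSymplecticSpectrum_truncation hT hsymm hpos n)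
  have hcircle : ∀ᵐ t ∂AddCircle.haarAddCircle, IsSymplecticSpectrum (A (circleRep t))
      (symplecticEigenvalues (A (circleRep t))) :=
    (ae_exists_isSymplecticSpectrum hA hT hsymm hpos).mono fun t ht =>
      isSymplecticSpectrum_symplecticEigenvalues ht
  refine ⟨hn, (ae_Icc_iff_ae_circle (P := fun θ => IsSymplecticSpectrum (A θ)
    (symplecticEigenvalues (A θ)))).2 hcircle, fun f hf => ?_⟩
  have hd : ∀ n j, symplecticEigenvalues (truncation A n) j ∈ Icc 0 (symbolNorm A) := fun n j =>
    ⟨((hn n).2.1 j).le, ((hn n).le_norm j).trans (norm_truncation_le hA n)⟩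
  have hD : ∀ᵐ t ∂AddCircle.haarAddCircle, ∀ j,
      symplecticEigenvalues (A (circleRep t)) j ∈ Icc 0 (symbolNorm A) := by
    filter_upwards [hcircle, ae_circle_norm_le_symbolNorm hA] with t h1 h2 j
    exact ⟨(h1.2.1 j).le, (h1.le_norm j).trans h2⟩
  -- The even moments of the limit, as traces of powers of the bounded symbol `J A`.
  have hB := isBoundedSymbol_complexJ_mul hA
  have htrace : ∀ q : ℕ, Integrable
      (fun t => Matrix.trace ((complexJ k * A (circleRep t)) ^ (2 * q))) AddCircle.haarAddCircle :=
    fun q => integrable_finsetSum _ fun a _ => integrable_of_memLp_top (hB.pow (2 * q) a a)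
  have hDq : ∀ q : ℕ, (fun t => ∑ j, (symplecticEigenvalues (A (circleRep t)) j ^ 2) ^ q)
      =ᵐ[AddCircle.haarAddCircle] fun t => (2⁻¹ * ((-1) ^ q *
        Matrix.trace ((complexJ k * A (circleRep t)) ^ (2 * q)))).re := fun q =>
    hcircle.mono fun t ht => ht.sum_pow_eq q
  have hmeas : ∀ q : ℕ, AEStronglyMeasurable
      (fun t => ∑ j, (symplecticEigenvalues (A (circleRep t)) j ^ 2) ^ q)
      AddCircle.haarAddCircle := fun q =>
    ((((htrace q).const_mul _).const_mul _).re.1).congr (hDq q).symm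
  have hmom : ∀ q : ℕ, Tendsto
      (fun n : ℕ => (n : ℝ)⁻¹ * ∑ j, (symplecticEigenvalues (truncation A n) j ^ 2) ^ q) atTop
      (𝓝 (∫ t, ∑ j, (symplecticEigenvalues (A (circleRep t)) j ^ 2) ^ q
        ∂AddCircle.haarAddCircle)) := by
    intro q
    have h1 := (((tendsto_trace_blockToeplitz_pow hB (2 * q)).const_mul ((-1) ^ q)).const_mul 2⁻¹)
    have h2 := (Complex.continuous_re.tendsto _).comp h1
    have h3 : ∫ t, ∑ j, (symplecticEigenvalues (A (circleRep t)) j ^ 2) ^ q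
        ∂AddCircle.haarAddCircle = (2⁻¹ * ((-1) ^ q *
          ∫ t, Matrix.trace ((complexJ k * A (circleRep t)) ^ (2 * q))
            ∂AddCircle.haarAddCircle)).re := by
      rw [integral_congr_ae (hDq q), ← integral_const_mul, ← integral_const_mul]
      exact integral_re (((htrace q).const_mul _).const_mul _)
    rw [h3]
    refine h2.congr fun n => ?_
    rw [(hn n).sum_pow_eq q, complexJ_mul_truncation hA, trace_submatrix_pow,
      ← Complex.re_ofReal_mul]
    simp only [Function.comp]
    congr 1
    push_cast
    ring
  obtain ⟨hint, hlim⟩ :=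
    integrable_and_tendsto_of_moments (symbolNorm_nonneg hA) hd hD hmeas hmom hf
  refine ⟨intervalIntegrable_of_integrable_circle
    (g := fun θ => ∑ j : Fin k, f (symplecticEigenvalues (A θ) j)) hint, ?_⟩
  rw [intervalIntegral_eq_integral_circle
    (fun θ => ∑ j : Fin k, f (symplecticEigenvalues (A θ) j)), one_div,
    inv_smul_smul₀ Real.two_pi_pos.ne']
  simpa only [one_div] using hlim
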